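/- Let $(X_i)_{i\ge 1}$ be a (strictly) stationary Gaussian process with $E X_i=0$, $E X_i^2=1$ and $\rho(k)=E X_1X_{1+k}=k^{-D}L(k)$ for all integers $k\ge 1$, where $0<D<1$ and $L$ is a slowly varying function (measurable, eventually positive, and $L(ax)/L(x)\to1$ as $x\to\infty$ for every $a>0$). Let $H_q$ denote the $q$-th probabilists' Hermite polynomial ($H_0=1$, $H_1(x)=x$, $H_2(x)=x^2-1,\dots$), and put $d_{n,m}^2=\operatorname{Var}\big(\sum_{i=1}^n H_m(X_i)\big)$, $d_{n,m}\ge 0$. Let $(G_n)_{n\ge1}$ be any sequence of measurable functions $G_n:\mathbb R\to\mathbb R$. Put $J_{q,n}(x)=E\big[1_{\{G_n(X_1)\le x\}}H_q(X_1)\big]$, and let $m(n)=\min\{q\ge 1 : J_{q,n}(x)\neq0 \text{ for some } x\in\mathbb R\}$ be the Hermite rank of the class $\{1_{\{G_n(\cdot)\le x\}}\}_{x\in\mathbb R}$ (with $m(n)=\infty$ if there is no such $q$). Let $m\in\mathbb N$ satisfy $m<1/D$ and, for some $n_0$, $m(n)\le m$ for all $n\ge n_0$. Then there are constants $C>0$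 and $\kappa>0$, depending neither on $n$ nor on $\epsilon$, such that for all $n\ge1$ and all $\epsilon>0$ $$P\left(\sup_{t\in(0,1)}\ \sup_{x\in\mathbb R}\ \frac1{d_{n,m}}\left|\sum_{i=1}^{\lfloor nt\rfloor}\Big(1_{\{G_n(X_i)\le x\}}-\sum_{q=0}^m\frac{J_{q,n}(x)}{q!}H_q(X_i)\Big)\right|>\epsilon\right)\le C\,n^{-\kappa}\,(1+\epsilon^{-3}).$$ -/

import Mathlib

open MeasureTheory ProbabilityTheory Filter Topology

/-- A slowly varying function (at infinity), in the sense of Karamata. -/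
structure IsSlowlyVarying (L : ℝ → ℝ) : Prop where
  measurable : Measurable L
  eventually_pos : ∀ᶠ x in atTop, 0 < L x
  tendsto_ratio : ∀ a : ℝ, 0 < a → Tendsto (fun x => L (a * x) / L x) atTop (𝓝 1)

/-- Strict stationarity of a real sequence: every shift of the sequence has the same law. -/
def IsStrictlyStationary {Ω : Type*} [MeasurableSpace Ω] (X : ℕ → Ω → ℝ) (P : Measure Ω) : Prop :=
  ∀ k : ℕ, IdentDistrib (fun ω (i : ℕ) => X (i + k) ω) (fun ω (i : ℕ) => X i ω) P P

/-- The `q`-th (probabilists') Hermite polynomial as a real function: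
`H₀ = 1`, `H₁ = x`, `H₂ = x ^ 2 - 1`, ... -/
noncomputable def hermiteFun (q : ℕ) (x : ℝ) : ℝ :=
  Polynomial.aeval x (Polynomial.hermite q)

/-- The indicator `1_{G(y) ≤ x}`. -/
noncomputable def indLE (G : ℝ → ℝ) (x y : ℝ) : ℝ :=
  Set.indicator {z : ℝ | G z ≤ x} (fun _ => (1 : ℝ)) y

/-- The Hermite coefficient `J_q(x) = E[1_{G(ξ) ≤ x} H_q(ξ)]`. -/
noncomputable def hermiteCoeff {Ω : Type*} [MeasurableSpace Ω] (P : Measure Ω) (ξ : Ω → ℝ)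
    (G : ℝ → ℝ) (q : ℕ) (x : ℝ) : ℝ :=
  ∫ ω, indLE G x (ξ ω) * hermiteFun q (ξ ω) ∂P

/-- The Hermite rank of the class `{1_{G(·) ≤ x}}_{x ∈ ℝ}`: the least `q > 0` such that
`J_q(x) ≠ 0` for some real `x`; it is `⊤` if there is no such `q`. -/
noncomputable def hermiteRank {Ω : Type*} [MeasurableSpace Ω] (P : Measure Ω) (ξ : Ω → ℝ)
    (G : ℝ → ℝ) : ℕ∞ :=
  ⨅ (q : ℕ) (_ : 0 < q ∧ ∃ x : ℝ, hermiteCoeff P ξ G q x ≠ 0), (q : ℕ∞)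

/-- `d_{n,m}`, the standard deviation of the sum of `H_m` over the first `n` members of the
sequence. -/
noncomputable def hermiteNorm {Ω : Type*} [MeasurableSpace Ω] (P : Measure Ω) (X : ℕ → Ω → ℝ)
    (n m : ℕ) : ℝ :=
  Real.sqrt (variance (fun ω => ∑ i ∈ Finset.range n, hermiteFun m (X i ω)) P)

/-- The sum over the first `l` members of the sequence of
`1_{G(X_i) ≤ x} - ∑_{q = 0}^m (J_q(x) / q!) H_q(X_i)`.
All members of the sequence have the same law, so `J_q` is computed from the first one. -/
noncomputable def reducedSum {Ω : Type*} [MeasurableSpace Ω] (P : Measure Ω) (X : ℕ → Ω → ℝ)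
    (G : ℝ → ℝ) (m l : ℕ) (x : ℝ) (ω : Ω) : ℝ :=
  ∑ i ∈ Finset.range l, (indLE G x (X i ω) -
    ∑ q ∈ Finset.range (m + 1),
      hermiteCoeff P (X 0) G q x / (Nat.factorial q : ℝ) * hermiteFun q (X i ω))

/-- `sup_{0 < t < 1} sup_{x ∈ ℝ} (1 / d_{n,m}) |reducedSum up to ⌊n t⌋|`, a supremum of nonnegative
reals taken in `[0, ∞]`. -/
noncomputable def supReduced {Ω : Type*} [MeasurableSpace Ω] (P : Measure Ω) (X : ℕ → Ω → ℝ)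
    (G : ℝ → ℝ) (m n : ℕ) (ω : Ω) : ENNReal :=
  ⨆ t ∈ Set.Ioo (0 : ℝ) 1, ⨆ x : ℝ,
    ENNReal.ofReal (1 / hermiteNorm P X n m * |reducedSum P X G m ⌊(n : ℝ) * t⌋₊ x ω|)

/-! After subtraction of its Hermite expansion up to order `m`, an indicator has covariances of
order at most `|ρ k| ^ (m + 1)`, whereas `H_m` has covariances `m! * ρ k ^ m`. Since `m * D < 1`,
the reduced sums have a variance smaller by a power of `n` than `d_{n,m} ^ 2`, which is roughly `n ^
(2 - m * D)`. The task is to keep this gain under the two suprema; logarithmic losses are harmless.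

Pairwise bound: the normalized Hermite polynomials form a Hilbert basis of `L²` of the Gaussian, and
in this basis a Gaussian pair with correlation `ρ` acts diagonally with eigenvalues `ρ ^ p`. Hence
`abs_integral_comp_mul_comp_le`, and then `integral_sq_sum_reducedIndicator_le`: the second moment
of a block sum is linear in the block length and in the Gaussian measure of the set.

Suprema: the sublevel sets `{G ≤ x}` are bracketed by a chain of `O(n)` sets with brackets of mass
`O(1/n)` for a measure dominating the Hermite coefficients, so the bracketing error is bounded in
`L²`. Over the chain and over time, a two-parameter Rademacher-Menshov inequality bounds all sums at
once by dyadic blocks. The block measures telescope, so only powers of `log n` are lost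
(`exists_majorant_of_chain`). All constants are free of `G`, which may therefore vary with `n`.

Markov's inequality for the square gives a factor `ε ^ (-2) ≤ 1 + ε ^ (-3)`. Uniform convergence for
slowly varying functions bounds `L` between `x ^ (-δ)` and `x ^ δ`, which turns both variances into
powers of `n`. -/

/-! ### Hermite polynomials of Gaussian pairs -/

/-- The Hermite polynomials with real coefficients. -/
noncomputable def hermiteReal (q : ℕ) : Polynomial ℝ :=
  (Polynomial.hermite q).map (Int.castRingHom ℝ)

lemma hermiteFun_eq_eval (q : ℕ) (x : ℝ) : hermiteFun q x = (hermiteReal q).eval x := by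
  simp [hermiteFun, hermiteReal, Polynomial.aeval_def, Polynomial.eval₂_eq_eval_map]

lemma hermiteReal_succ (q : ℕ) :
    hermiteReal (q + 1) = Polynomial.X * hermiteReal q - (hermiteReal q).derivative := by
  simp [hermiteReal, Polynomial.hermite_succ, Polynomial.derivative_map]

lemma hermiteReal_zero : hermiteReal 0 = 1 := by simp [hermiteReal]

lemma derivative_hermiteReal_succ (q : ℕ) :
    (hermiteReal (q + 1)).derivative = Polynomial.C ((q : ℝ) + 1) * hermiteReal q := by
  induction q with
  | zero => simp [hermiteReal_succ, hermiteReal_zero]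
  | succ q ih =>
    rw [hermiteReal_succ (q + 1), Polynomial.derivative_sub, Polynomial.derivative_mul, ih,
      Polynomial.derivative_mul]
    simp only [Polynomial.derivative_X, Polynomial.derivative_C]
    rw [hermiteReal_succ q]
    push_cast
    simp only [map_add, map_one]
    ring

lemma measurable_hermiteFun (q : ℕ) : Measurable (hermiteFun q) := by
  simp only [funext (hermiteFun_eq_eval q)]
  exact (hermiteReal q).continuous.measurable

lemma memLp_pow_of_map_eq_gaussianReal {Ω : Type*} [MeasurableSpace Ω] {P : Measure Ω}
    {X : Ω → ℝ} (hX : MeasurePreserving X P (gaussianReal 0 1)) (k : ℕ) (p : NNReal) :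
    MemLp (fun ω => X ω ^ k) p P := by
  have h1 : MemLp (fun x : ℝ => x ^ k) p (gaussianReal 0 1) := by
    by_cases hk : k = 0
    · subst hk
      simpa using memLp_const (1 : ℝ)
    · have h2 : MemLp (id : ℝ → ℝ) ((p * k : NNReal)) (gaussianReal 0 1) :=
        memLp_id_gaussianReal _
      have h3 := (h2.norm_rpow_div (q := (k : ENNReal)))
      have h4 : ((p * k : NNReal) : ENNReal) / (k : ENNReal) = p := by
        push_cast
        exact ENNReal.mul_div_cancel_right (by exact_mod_cast hk) (by simp)
      rw [h4] at h3
      refine h3.congr_norm (by fun_prop) (ae_of_all _ fun x => ?_)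
      simp
  exact h1.comp_measurePreserving hX

lemma memLp_eval_of_map_eq_gaussianReal {Ω : Type*} [MeasurableSpace Ω] {P : Measure Ω}
    {X : Ω → ℝ} (hX : MeasurePreserving X P (gaussianReal 0 1)) (f : Polynomial ℝ) {p : ENNReal} (hp : p ≠ ⊤) :
    MemLp (fun ω => f.eval (X ω)) p P := by
  lift p to NNReal using hp
  simp only [Polynomial.eval_eq_sum_range]
  exact memLp_finsetSum _ fun i _ => (memLp_pow_of_map_eq_gaussianReal hX i p).const_mul _

lemma integrable_eval_gaussianReal (f : Polynomial ℝ) :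
    Integrable (fun x => f.eval x) (gaussianReal 0 1) :=
  memLp_one_iff_integrable.1 (memLp_eval_of_map_eq_gaussianReal (MeasurePreserving.id _) f
    (by simp))

/-- Gaussian integration by parts for polynomials. -/
lemma integral_mul_eval_gaussianReal (f : Polynomial ℝ) :
    ∫ x, x * f.eval x ∂(gaussianReal 0 1) = ∫ x, f.derivative.eval x ∂(gaussianReal 0 1) := by
  have hI : ∀ g : Polynomial ℝ, Integrable (fun x => gaussianPDFReal 0 1 x * g.eval x) := by
    intro g
    have h := integrable_eval_gaussianReal g
    rw [gaussianReal_of_var_ne_zero 0 one_ne_zero] at h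
    rw [integrable_withDensity_iff_integrable_smul₀'
      (measurable_gaussianPDF 0 1).aemeasurable (by simp [gaussianPDF])] at h
    simpa [toReal_gaussianPDF] using h
  have hd : ∀ x, HasDerivAt (fun x => gaussianPDFReal 0 1 x * f.eval x)
      (gaussianPDFReal 0 1 x * (f.derivative - Polynomial.X * f).eval x) x := by
    intro x
    have h1 : HasDerivAt (gaussianPDFReal 0 1) (gaussianPDFReal 0 1 x * (-x)) x := by
      have : gaussianPDFReal 0 1 = fun x => (√(2 * Real.pi * 1))⁻¹ * Real.exp (-x ^ 2 / 2) := by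
        ext x; simp [gaussianPDFReal]
      rw [this]
      have h2 : HasDerivAt (fun x : ℝ => -x ^ 2 / 2) (-x) x :=
        (((hasDerivAt_pow 2 x).neg).div_const 2).congr_deriv (by norm_num; ring)
      exact (h2.exp.const_mul _).congr_deriv (by ring)
    refine (h1.mul (f.hasDerivAt x)).congr_deriv ?_
    rw [Polynomial.eval_sub, Polynomial.eval_mul, Polynomial.eval_X]
    ring
  have h0 := integral_eq_zero_of_hasDerivAt_of_integrable hd (hI _) (hI f)
  rw [integral_gaussianReal_eq_integral_smul one_ne_zero,
    integral_gaussianReal_eq_integral_smul one_ne_zero]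
  simp only [smul_eq_mul]
  have h1 := hI (Polynomial.X * f)
  have h2 := hI f.derivative
  rw [← sub_eq_zero, ← integral_sub (by simpa using h1) h2, ← neg_eq_zero, ← integral_neg]
  refine Eq.trans (integral_congr_ae (ae_of_all _ fun x => ?_)) h0
  simp only [Polynomial.eval_sub, Polynomial.eval_mul, Polynomial.eval_X]; ring

lemma integrable_eval_mul_eval {Ω : Type*} [MeasurableSpace Ω] {P : Measure Ω} {X Y : Ω → ℝ}
    (hX : MeasurePreserving X P (gaussianReal 0 1)) (hY : MeasurePreserving Y P (gaussianReal 0 1))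
    (f g : Polynomial ℝ) : Integrable (fun ω => f.eval (X ω) * g.eval (Y ω)) P :=
  (memLp_eval_of_map_eq_gaussianReal hX f (p := 2) (by simp)).integrable_mul
    (memLp_eval_of_map_eq_gaussianReal hY g (p := 2) (by simp))

lemma integral_comp_of_measurePreserving {Ω : Type*} [MeasurableSpace Ω] {P : Measure Ω}
    {ν : Measure ℝ} {X : Ω → ℝ} (hX : MeasurePreserving X P ν) {f : ℝ → ℝ} (hf : Measurable f) :
    ∫ ω, f (X ω) ∂P = ∫ x, f x ∂ν := by
  rw [← hX.map_eq, integral_map hX.measurable.aemeasurable hf.aestronglyMeasurable]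

/-- Gaussian integration by parts for a standard bivariate Gaussian vector. -/
lemma integral_mul_eval_mul_eval {Ω : Type*} [MeasurableSpace Ω] {P : Measure Ω}
    [IsProbabilityMeasure P] {X Y : Ω → ℝ}
    (hX : MeasurePreserving X P (gaussianReal 0 1)) (hY : MeasurePreserving Y P (gaussianReal 0 1))
    (hXY : HasGaussianLaw (fun ω => (X ω, Y ω)) P) (f g : Polynomial ℝ) :
    ∫ ω, X ω * f.eval (X ω) * g.eval (Y ω) ∂P =
      ∫ ω, f.derivative.eval (X ω) * g.eval (Y ω) ∂P +
        (∫ ω, X ω * Y ω ∂P) * ∫ ω, f.eval (X ω) * g.derivative.eval (Y ω) ∂P := by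
  set ρ := ∫ ω, X ω * Y ω ∂P with hρ
  -- The residual `Z` is uncorrelated with `X`, hence independent of it. With `Z = z` fixed, `g (Y)`
  -- is the polynomial `g (ρ x + z)` in `x`, so the one-dimensional formula applies and the chain
  -- rule produces the factor `ρ`.
  let Z : Ω → ℝ := fun ω => Y ω - ρ * X ω
  have hZm : Measurable Z := hY.measurable.sub (hX.measurable.const_mul ρ)
  have hXZ : HasGaussianLaw (fun ω => (X ω, Z ω)) P := by
    let T : ℝ × ℝ →L[ℝ] ℝ × ℝ := (ContinuousLinearMap.fst ℝ ℝ ℝ).prod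
      (ContinuousLinearMap.snd ℝ ℝ ℝ - ρ • ContinuousLinearMap.fst ℝ ℝ ℝ)
    exact hXY.map_fun T
  have mX : ∫ ω, X ω ∂P = 0 := by
    refine (integral_comp_of_measurePreserving hX measurable_id).trans ?_
    exact integral_id_gaussianReal
  have mXX : ∫ ω, X ω * X ω ∂P = 1 := by
    refine (integral_comp_of_measurePreserving hX (measurable_id.mul measurable_id)).trans ?_
    simpa using integral_mul_eval_gaussianReal Polynomial.X
  have hind : IndepFun X Z P := by
    refine hXZ.indepFun_of_covariance_eq_zero ?_
    rw [covariance_eq_sub hXZ.fst.memLp_two hXZ.snd.memLp_two, mX, zero_mul, sub_zero]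
    have h1 := integrable_eval_mul_eval hX hY Polynomial.X Polynomial.X
    have h2 := integrable_eval_mul_eval hX hX Polynomial.X Polynomial.X
    simp only [Polynomial.eval_X] at h1 h2
    have : ∀ ω, (X * Z) ω = X ω * Y ω - ρ * (X ω * X ω) := fun ω => by
      simp only [Pi.mul_apply, Z]; ring
    simp only [this]
    rw [integral_sub h1 (h2.const_mul ρ), integral_const_mul, mXX, ← hρ]
    ring
  set ν := P.map Z
  have : IsProbabilityMeasure ν := Measure.isProbabilityMeasure_map hZm.aemeasurable
  have hmap : P.map (fun ω => (X ω, Z ω)) = (gaussianReal 0 1).prod ν := by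
    rw [(indepFun_iff_map_prod_eq_prod_map_map hX.measurable.aemeasurable hZm.aemeasurable).1 hind,
      hX.map_eq]
  have hpair : Measurable (fun ω => (X ω, Z ω)) := hX.measurable.prodMk hZm
  have key : ∀ a b : Polynomial ℝ,
      ∫ ω, a.eval (X ω) * b.eval (Y ω) ∂P =
        ∫ z, ∫ x, (a * b.comp (Polynomial.C ρ * Polynomial.X + Polynomial.C z)).eval x
          ∂(gaussianReal 0 1) ∂ν ∧
      Integrable (fun z => ∫ x, (a * b.comp (Polynomial.C ρ * Polynomial.X +
        Polynomial.C z)).eval x ∂(gaussianReal 0 1)) ν := by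
    intro a b
    let F : ℝ × ℝ → ℝ := fun w => a.eval w.1 * b.eval (ρ * w.1 + w.2)
    have hF : Continuous F := by
      have := a.continuous; have := b.continuous; fun_prop
    have e1 : ∀ ω, a.eval (X ω) * b.eval (Y ω) = F (X ω, Z ω) := fun ω => by simp [F, Z]
    have hI : Integrable F ((gaussianReal 0 1).prod ν) := by
      rw [← hmap, integrable_map_measure hF.aestronglyMeasurable hpair.aemeasurable]
      exact (integrable_eval_mul_eval hX hY a b).congr (ae_of_all _ e1)
    have e2 : ∀ z, ∫ x, (a * b.comp (Polynomial.C ρ * Polynomial.X + Polynomial.C z)).eval x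
        ∂(gaussianReal 0 1) = ∫ x, F (x, z) ∂(gaussianReal 0 1) := fun z => by
      simp [F, Polynomial.eval_comp]
    simp only [e1, e2]
    refine ⟨?_, hI.integral_prod_right⟩
    rw [← integral_prod_symm _ hI, ← hmap, integral_map hpair.aemeasurable
      hF.aestronglyMeasurable]
  have h1 := (key (Polynomial.X * f) g).1
  simp only [Polynomial.eval_mul, Polynomial.eval_X] at h1
  rw [h1, (key f.derivative g).1, (key f g.derivative).1, ← integral_const_mul,
    ← integral_add (key f.derivative g).2 ((key f g.derivative).2.const_mul ρ)]
  refine integral_congr_ae (ae_of_all _ fun z => ?_)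
  have h2 := integral_mul_eval_gaussianReal
    (f * g.comp (Polynomial.C ρ * Polynomial.X + Polynomial.C z))
  have h3 : (f * g.comp (Polynomial.C ρ * Polynomial.X + Polynomial.C z)).derivative =
      f.derivative * g.comp (Polynomial.C ρ * Polynomial.X + Polynomial.C z) + Polynomial.C ρ *
        (f * g.derivative.comp (Polynomial.C ρ * Polynomial.X + Polynomial.C z)) := by
    simp [Polynomial.derivative_mul, Polynomial.derivative_comp]; ring
  rw [h3] at h2
  simp only [Polynomial.eval_add, Polynomial.eval_mul, Polynomial.eval_C] at h2 ⊢
  have i1 := integrable_eval_gaussianReal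
    (f.derivative * g.comp (Polynomial.C ρ * Polynomial.X + Polynomial.C z))
  have i2 := integrable_eval_gaussianReal
    (f * g.derivative.comp (Polynomial.C ρ * Polynomial.X + Polynomial.C z))
  simp only [Polynomial.eval_mul] at i1 i2
  rw [integral_add i1 (i2.const_mul ρ), integral_const_mul] at h2
  simpa [mul_assoc] using h2

/-- Integration by parts lowers the degree of `H_p` by one and differentiates `H_q`, at the cost of
one factor `ρ`; the derivatives accumulate the factorial. For `p ≠ q` one index reaches zero first,
leaving the mean of a higher Hermite polynomial or the derivative of a constant. -/
lemma integral_hermiteFun_mul_hermiteFun {Ω : Type*} [MeasurableSpace Ω] {P : Measure Ω}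
    [IsProbabilityMeasure P] {X Y : Ω → ℝ}
    (hX : MeasurePreserving X P (gaussianReal 0 1)) (hY : MeasurePreserving Y P (gaussianReal 0 1))
    (hXY : HasGaussianLaw (fun ω => (X ω, Y ω)) P) (p q : ℕ) :
    ∫ ω, hermiteFun p (X ω) * hermiteFun q (Y ω) ∂P =
      if p = q then (p.factorial : ℝ) * (∫ ω, X ω * Y ω ∂P) ^ p else 0 := by
  simp only [hermiteFun_eq_eval]
  have hsucc : ∀ p (g : Polynomial ℝ),
      ∫ ω, (hermiteReal (p + 1)).eval (X ω) * g.eval (Y ω) ∂P =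
      (∫ ω, X ω * Y ω ∂P) * ∫ ω, (hermiteReal p).eval (X ω) * g.derivative.eval (Y ω) ∂P := by
    intro p g
    have h := integral_mul_eval_mul_eval hX hY hXY (hermiteReal p) g
    have i1 := integrable_eval_mul_eval hX hY (Polynomial.X * hermiteReal p) g
    have i2 := integrable_eval_mul_eval hX hY (hermiteReal p).derivative g
    simp only [Polynomial.eval_mul, Polynomial.eval_X] at i1
    rw [hermiteReal_succ]
    simp only [Polynomial.eval_sub, Polynomial.eval_mul, Polynomial.eval_X, sub_mul]
    rw [integral_sub i1 i2, h]
    ring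
  induction p generalizing q with
  | zero =>
    cases q with
    | zero => simp [hermiteReal_zero]
    | succ q =>
      have h := integral_mul_eval_gaussianReal (hermiteReal q)
      have i1 := integrable_eval_gaussianReal (Polynomial.X * hermiteReal q)
      have i2 := integrable_eval_gaussianReal (hermiteReal q).derivative
      simp only [Polynomial.eval_mul, Polynomial.eval_X] at i1
      simp only [hermiteReal_zero, Polynomial.eval_one, one_mul]
      rw [integral_comp_of_measurePreserving hY
        (f := fun x => (hermiteReal (q + 1)).eval x) (Polynomial.continuous _).measurable,
        hermiteReal_succ]
      simp only [Polynomial.eval_sub, Polynomial.eval_mul, Polynomial.eval_X]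
      rw [integral_sub i1 i2, h]
      simp
  | succ p ih =>
    rw [hsucc]
    cases q with
    | zero => simp [hermiteReal_zero]
    | succ q =>
      rw [derivative_hermiteReal_succ]
      simp only [Polynomial.eval_mul, Polynomial.eval_C]
      simp only [mul_left_comm _ ((q : ℝ) + 1)]
      rw [integral_const_mul, ih]
      by_cases hpq : p = q
      · subst hpq
        simp [Nat.factorial_succ]; ring
      · simp [hpq]

/-! ### Completeness of the Hermite polynomials -/

lemma integrable_mul_exp_abs_gaussianReal {f : ℝ → ℝ} (hf : MemLp f 2 (gaussianReal 0 1)) (t : ℝ) :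
    Integrable (fun x => |f x| * Real.exp (|t * x|)) (gaussianReal 0 1) := by
  have hexp : ∀ s : ℝ, MemLp (fun x => Real.exp (s * x)) 2 (gaussianReal 0 1) := by
    intro s
    rw [memLp_two_iff_integrable_sq (by fun_prop)]
    refine (integrable_exp_mul_gaussianReal (μ := 0) (v := 1) (2 * s)).congr
      (ae_of_all _ fun x => ?_)
    change _ = Real.exp (s * x) ^ 2
    rw [← Real.exp_nat_mul]; push_cast; ring_nf
  have h1 : MemLp (fun x => Real.exp (t * x) + Real.exp (-t * x)) 2 (gaussianReal 0 1) :=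
    (hexp t).add (hexp (-t))
  refine (hf.abs.integrable_mul h1).mono' (by
    have := hf.aestronglyMeasurable
    fun_prop) (ae_of_all _ fun x => ?_)
  rw [Real.norm_of_nonneg (by positivity)]
  refine mul_le_mul_of_nonneg_left ?_ (abs_nonneg (f x))
  rcases abs_cases (t * x) with ⟨h, _⟩ | ⟨h, _⟩ <;> rw [h]
  · linarith [Real.exp_pos (-t * x)]
  · rw [← neg_mul]; linarith [Real.exp_pos (t * x)]

/-- In the exponential series every term integrates to zero by the moment hypothesis. Summation and
integration may be exchanged because the integrated norms have partial sums at most `∫ |f x| exp |t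
x|`. -/
lemma integral_mul_cexp_eq_zero {f : ℝ → ℝ} (hf : MemLp f 2 (gaussianReal 0 1))
    (h : ∀ k : ℕ, ∫ x, f x * x ^ k ∂(gaussianReal 0 1) = 0) (t : ℝ) :
    ∫ x, (f x : ℂ) * Complex.exp (t * x * Complex.I) ∂(gaussianReal 0 1) = 0 := by
  let F : ℕ → ℝ → ℂ := fun k x =>
    (f x : ℂ) * ((t * x * Complex.I) ^ k / (k.factorial : ℂ))
  have hbase := integrable_mul_exp_abs_gaussianReal hf t
  have hF : ∀ k, F k = fun x => ((t * Complex.I) ^ k / (k.factorial : ℂ)) *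
      ((f x * x ^ k : ℝ) : ℂ) := fun k => by
    ext x; simp only [F]; push_cast; rw [mul_right_comm, mul_pow]; ring
  have hnorm : ∀ k x, ‖F k x‖ = |f x| * (|t * x| ^ k / (k.factorial : ℝ)) := fun k x => by
    simp [F, abs_mul]
  have hint : ∀ k, Integrable (F k) (gaussianReal 0 1) := by
    intro k
    rw [hF]
    refine Integrable.const_mul (Integrable.ofReal ?_) _
    have hk := memLp_eval_of_map_eq_gaussianReal (MeasurePreserving.id (gaussianReal 0 1))
      (Polynomial.X ^ k) (p := 2) (by simp)
    simp only [Polynomial.eval_pow, Polynomial.eval_X] at hk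
    exact hf.integrable_mul hk
  have hsum : Summable fun k => ∫ x, ‖F k x‖ ∂(gaussianReal 0 1) := by
    refine summable_of_sum_range_le (c := ∫ x, |f x| * Real.exp (|t * x|) ∂(gaussianReal 0 1))
      (fun k => integral_nonneg fun x => norm_nonneg _) fun n => ?_
    rw [← integral_finsetSum _ fun k _ => (hint k).norm]
    refine integral_mono (integrable_finsetSum _ fun k _ => (hint k).norm) hbase fun x => ?_
    simp only [hnorm, ← Finset.mul_sum]
    gcongr
    exact Real.sum_le_exp_of_nonneg (abs_nonneg _) n
  have hs := hasSum_integral_of_summable_integral_norm hint hsum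
  have hz : ∀ k, ∫ x, F k x ∂(gaussianReal 0 1) = 0 := fun k => by
    rw [hF, integral_const_mul, integral_complex_ofReal, h k]; simp
  simp only [hz] at hs
  rw [hasSum_zero.unique hs]
  refine integral_congr_ae (ae_of_all _ fun x => ?_)
  simp only [F]
  rw [tsum_mul_left, Complex.exp_eq_exp_ℂ, NormedSpace.exp_eq_tsum_div]

/-- Polynomials are total in `L²` of the standard Gaussian measure. -/
lemma ae_eq_zero_of_forall_integral_mul_pow_eq_zero {f : ℝ → ℝ} (hfm : Measurable f)
    (hf : MemLp f 2 (gaussianReal 0 1))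
    (h : ∀ k : ℕ, ∫ x, f x * x ^ k ∂(gaussianReal 0 1) = 0) : f =ᵐ[gaussianReal 0 1] 0 := by
  have hf1 : Integrable f (gaussianReal 0 1) := hf.integrable (by norm_num)
  -- `ENNReal.ofReal` truncates at zero, so the two densities are the positive and negative parts of
  -- `f`. Equality of their characteristic functions forces the two parts to agree, hence to vanish,
  -- almost everywhere.
  let μ₁ := (gaussianReal 0 1).withDensity fun x => ENNReal.ofReal (f x)
  let μ₂ := (gaussianReal 0 1).withDensity fun x => ENNReal.ofReal (-f x)
  have : IsFiniteMeasure μ₁ := isFiniteMeasure_withDensity_ofReal hf1.2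
  have : IsFiniteMeasure μ₂ := isFiniteMeasure_withDensity_ofReal hf1.neg.2
  have hmul : ∀ (g : ℝ → ℝ) (t : ℝ), Integrable g (gaussianReal 0 1) →
      Integrable (fun x => (g x : ℂ) * Complex.exp (t * x * Complex.I)) (gaussianReal 0 1) := by
    intro g t hg
    refine hg.ofReal.mul_of_top_left (memLp_top_of_bound (by fun_prop) 1 (ae_of_all _ fun x => ?_))
    rw [← Complex.ofReal_mul, Complex.norm_exp_ofReal_mul_I]
  have heq : μ₁ = μ₂ := by
    refine Measure.ext_of_charFun (funext fun t => ?_)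
    rw [charFun_apply_real, charFun_apply_real,
      integral_withDensity_eq_integral_toReal_smul (by fun_prop) (by simp),
      integral_withDensity_eq_integral_toReal_smul (by fun_prop) (by simp), ← sub_eq_zero]
    have i1 := hmul _ t hf1.pos_part
    have i2 := hmul _ t hf1.neg_part
    have e : ∀ (r : ℝ) (z : ℂ), (ENNReal.ofReal r).toReal • z = ((max r 0 : ℝ) : ℂ) * z :=
      fun r z => by rw [ENNReal.toReal_ofReal']; simp
    simp only [e]
    rw [← integral_sub i1 i2, ← integral_mul_cexp_eq_zero hf h t]
    refine integral_congr_ae (ae_of_all _ fun x => ?_)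
    simp only [← sub_mul, ← Complex.ofReal_sub]
    congr 2
    rcases le_total (f x) 0 with h | h
    · rw [max_eq_right h, max_eq_left (by linarith)]; ring
    · rw [max_eq_left h, max_eq_right (by linarith)]; ring
  have hae := (withDensity_eq_iff (by fun_prop) (by fun_prop) 
    (hasFiniteIntegral_iff_enorm.1 hf1.2 |>.trans_le' (lintegral_mono fun x => by
      rw [← ofReal_norm]; exact ENNReal.ofReal_le_ofReal (le_abs_self _))).ne).1 heq
  filter_upwards [hae] with x hx
  rcases le_total (f x) 0 with h | h
  · rw [ENNReal.ofReal_of_nonpos h, eq_comm, ENNReal.ofReal_eq_zero] at hx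
    exact le_antisymm h (neg_nonpos.1 hx)
  · rw [ENNReal.ofReal_of_nonpos (by linarith : -f x ≤ 0), ENNReal.ofReal_eq_zero] at hx
    exact le_antisymm hx h

lemma L2_inner_toLp {α : Type*} [MeasurableSpace α] {μ : Measure α} {f g : α → ℝ}
    (hf : MemLp f 2 μ) (hg : MemLp g 2 μ) :
    inner ℝ (hf.toLp f) (hg.toLp g) = ∫ x, f x * g x ∂μ := by
  rw [L2.inner_def]
  refine integral_congr_ae ?_
  filter_upwards [hf.coeFn_toLp, hg.coeFn_toLp] with x h1 h2
  simp [h1, h2, mul_comm]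

lemma memLp_hermiteFun (q : ℕ) : MemLp (hermiteFun q) 2 (gaussianReal 0 1) := by
  simp only [funext (hermiteFun_eq_eval q)]
  exact memLp_eval_of_map_eq_gaussianReal (MeasurePreserving.id _) _ (by simp)

/-- The normalized Hermite polynomials in `L²` of the standard Gaussian measure. -/
noncomputable def hermiteLp (q : ℕ) : Lp ℝ 2 (gaussianReal 0 1) :=
  (√(q.factorial : ℝ))⁻¹ • (memLp_hermiteFun q).toLp _

lemma inner_hermiteLp_comp {Ω : Type*} [MeasurableSpace Ω] {P : Measure Ω}
    [IsProbabilityMeasure P] {X Y : Ω → ℝ}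
    (hX : MeasurePreserving X P (gaussianReal 0 1)) (hY : MeasurePreserving Y P (gaussianReal 0 1))
    (hXY : HasGaussianLaw (fun ω => (X ω, Y ω)) P) (p q : ℕ) :
    inner ℝ (Lp.compMeasurePreservingₗᵢ ℝ X hX (hermiteLp p))
      (Lp.compMeasurePreservingₗᵢ ℝ Y hY (hermiteLp q)) =
      if p = q then (∫ ω, X ω * Y ω ∂P) ^ p else 0 := by
  simp only [hermiteLp, map_smul, inner_smul_left, inner_smul_right]
  have h : inner ℝ (Lp.compMeasurePreservingₗᵢ ℝ X hX ((memLp_hermiteFun p).toLp _))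
      (Lp.compMeasurePreservingₗᵢ ℝ Y hY ((memLp_hermiteFun q).toLp _)) =
      ∫ ω, hermiteFun p (X ω) * hermiteFun q (Y ω) ∂P :=
    L2_inner_toLp ((memLp_hermiteFun p).comp_measurePreserving hX)
      ((memLp_hermiteFun q).comp_measurePreserving hY)
  rw [h, integral_hermiteFun_mul_hermiteFun hX hY hXY]
  split_ifs with hpq
  · subst hpq
    have : √(p.factorial : ℝ) * √(p.factorial : ℝ) = p.factorial := Real.mul_self_sqrt (by positivity)
    have h0 : √(p.factorial : ℝ) ≠ 0 := by positivity
    simp only [conj_trivial]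
    rw [← mul_assoc, ← mul_assoc, ← mul_inv, this, inv_mul_cancel₀ (by positivity), one_mul]
  · simp

lemma hasGaussianLaw_diag : HasGaussianLaw (fun x : ℝ => (id x, id x)) (gaussianReal 0 1) :=
  (IsGaussian.hasGaussianLaw_id (μ := gaussianReal 0 1)).map_fun
    ((ContinuousLinearMap.id ℝ ℝ).prod (ContinuousLinearMap.id ℝ ℝ))

lemma integral_mul_self_gaussianReal : ∫ x : ℝ, x * x ∂(gaussianReal 0 1) = 1 := by
  simpa using integral_mul_eval_gaussianReal Polynomial.X

lemma orthonormal_hermiteLp : Orthonormal ℝ hermiteLp := by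
  rw [orthonormal_iff_ite]
  intro p q
  have h := inner_hermiteLp_comp (MeasurePreserving.id (gaussianReal 0 1))
    (MeasurePreserving.id (gaussianReal 0 1)) hasGaussianLaw_diag p q
  simp only [id, integral_mul_self_gaussianReal, one_pow] at h
  rw [← h]
  change _ = inner ℝ (Lp.compMeasurePreserving id _ _) (Lp.compMeasurePreserving id _ _)
  rw [Lp.compMeasurePreserving_id_apply, Lp.compMeasurePreserving_id_apply]

lemma span_hermiteReal : Submodule.span ℝ (Set.range hermiteReal) = ⊤ := by
  have hd : ∀ i, (hermiteReal i).degree = i := fun i => by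
    rw [hermiteReal, (Polynomial.hermite_monic i).degree_map, Polynomial.degree_hermite]
  let S : Polynomial.Sequence ℝ := ⟨hermiteReal, hd⟩
  refine S.span fun i => ?_
  have : (hermiteReal i).Monic := (Polynomial.hermite_monic i).map _
  change IsUnit (hermiteReal i).leadingCoeff
  rw [this.leadingCoeff]; exact isUnit_one

lemma span_hermiteLp_orthogonal : (Submodule.span ℝ (Set.range hermiteLp))ᗮ = ⊥ := by
  rw [Submodule.eq_bot_iff]
  intro f hf
  have hfL := Lp.memLp f
  have hp : ∀ p : Polynomial ℝ, Integrable (fun x => f x * p.eval x) (gaussianReal 0 1) := fun p =>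
    hfL.integrable_mul (memLp_eval_of_map_eq_gaussianReal (MeasurePreserving.id _) p
      (p := 2) (by simp))
  have hH : ∀ q, ∫ x, f x * (hermiteReal q).eval x ∂(gaussianReal 0 1) = 0 := by
    intro q
    have h := (Submodule.mem_orthogonal' _ f).1 hf (hermiteLp q) (Submodule.subset_span ⟨q, rfl⟩)
    rw [hermiteLp, inner_smul_right, ← Lp.toLp_coeFn f hfL, L2_inner_toLp] at h
    simp only [← hermiteFun_eq_eval]
    refine (mul_eq_zero.1 h).resolve_left (by positivity)
  have hall : ∀ p : Polynomial ℝ, ∫ x, f x * p.eval x ∂(gaussianReal 0 1) = 0 := by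
    intro p
    have hpS : p ∈ Submodule.span ℝ (Set.range hermiteReal) := by rw [span_hermiteReal]; trivial
    induction hpS using Submodule.span_induction with
    | mem x h => obtain ⟨q, rfl⟩ := h; exact hH q
    | zero => simp
    | add x y _ _ hx hy =>
      simp only [Polynomial.eval_add, mul_add]
      rw [integral_add (hp x) (hp y), hx, hy, add_zero]
    | smul a x _ hx =>
      simp only [Polynomial.eval_smul, smul_eq_mul, mul_left_comm _ a]
      rw [integral_const_mul, hx, mul_zero]
  have h0 := ae_eq_zero_of_forall_integral_mul_pow_eq_zero (Lp.stronglyMeasurable f).measurable hfL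
    fun k => by simpa using hall (Polynomial.X ^ k)
  exact (Lp.eq_zero_iff_ae_eq_zero).2 h0

/-- The Hilbert basis of normalized Hermite polynomials. -/
noncomputable def hermiteBasis : HilbertBasis ℕ ℝ (Lp ℝ 2 (gaussianReal 0 1)) :=
  HilbertBasis.mkOfOrthogonalEqBot orthonormal_hermiteLp span_hermiteLp_orthogonal

lemma coe_hermiteBasis : ⇑hermiteBasis = hermiteLp :=
  HilbertBasis.coe_mkOfOrthogonalEqBot _ _

/-! ### Correlation inequality -/

/-- The correlation inequality for functions of a standard bivariate Gaussian vector which are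
orthogonal to the first Hermite polynomials. -/
lemma abs_integral_comp_mul_comp_le {Ω : Type*} [MeasurableSpace Ω] {P : Measure Ω}
    [IsProbabilityMeasure P] {X Y : Ω → ℝ}
    (hX : MeasurePreserving X P (gaussianReal 0 1)) (hY : MeasurePreserving Y P (gaussianReal 0 1))
    (hXY : HasGaussianLaw (fun ω => (X ω, Y ω)) P) (hρ : |∫ ω, X ω * Y ω ∂P| ≤ 1) {f : ℝ → ℝ}
    (hf : MemLp f 2 (gaussianReal 0 1)) (k : ℕ)
    (hk : ∀ q < k, ∫ x, f x * hermiteFun q x ∂(gaussianReal 0 1) = 0) :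
    |∫ ω, f (X ω) * f (Y ω) ∂P| ≤
      |∫ ω, X ω * Y ω ∂P| ^ k * ∫ x, f x ^ 2 ∂(gaussianReal 0 1) := by
  set ρ := ∫ ω, X ω * Y ω ∂P
  set F := hf.toLp f
  set U := Lp.compMeasurePreservingₗᵢ (E := ℝ) (p := 2) ℝ X hX
  set V := Lp.compMeasurePreservingₗᵢ (E := ℝ) (p := 2) ℝ Y hY
  have e1 : inner ℝ (U F) (V F) = ∫ ω, f (X ω) * f (Y ω) ∂P :=
    L2_inner_toLp (hf.comp_measurePreserving hX) (hf.comp_measurePreserving hY)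
  let c : ℕ → ℝ := fun q => hermiteBasis.repr F q
  have hc : ∀ q, c q = inner ℝ (hermiteLp q) F := fun q => by
    simp only [c]; rw [hermiteBasis.repr_apply_apply, coe_hermiteBasis]
  have hc0 : ∀ q < k, c q = 0 := fun q hq => by
    rw [hc, hermiteLp, inner_smul_left, L2_inner_toLp]
    simp only [mul_comm (hermiteFun q _)]
    rw [hk q hq, mul_zero]
  have hsumF := hermiteBasis.hasSum_repr F
  simp only [coe_hermiteBasis] at hsumF
  have hV : ∀ p, inner ℝ (U (hermiteLp p)) (V F) = c p * ρ ^ p := by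
    intro p
    have h := hsumF.mapL ((innerSL ℝ (U (hermiteLp p))).comp V.toContinuousLinearMap)
    have e : ∀ q, ((innerSL ℝ (U (hermiteLp p))).comp V.toContinuousLinearMap)
        (hermiteBasis.repr F q • hermiteLp q) = if q = p then c p * ρ ^ p else 0 := by
      intro q
      rw [map_smul, ContinuousLinearMap.comp_apply, LinearIsometry.coe_toContinuousLinearMap,
        innerSL_apply_apply, inner_hermiteLp_comp hX hY hXY]
      by_cases h : q = p
      · simp [h, c, ρ]
      · simp [h, Ne.symm h]
    simp only [e] at h
    exact h.unique (hasSum_ite_eq p (c p * ρ ^ p))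
  -- Mehler's formula. The terms below `k` vanish, `|ρ| ^ p ≤ |ρ| ^ k` for the others, and
  -- Parseval's identity sums what remains.
  have hUV : HasSum (fun p => c p ^ 2 * ρ ^ p) (inner ℝ (U F) (V F)) := by
    have h := hsumF.mapL ((innerSL ℝ (V F)).comp U.toContinuousLinearMap)
    have e : ∀ p, ((innerSL ℝ (V F)).comp U.toContinuousLinearMap)
        (hermiteBasis.repr F p • hermiteLp p) = c p ^ 2 * ρ ^ p := by
      intro p
      rw [map_smul, ContinuousLinearMap.comp_apply, LinearIsometry.coe_toContinuousLinearMap,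
        innerSL_apply_apply, real_inner_comm, hV, smul_eq_mul]
      simp only [c]; ring
    simp only [e] at h
    rw [real_inner_comm]
    exact h
  have hcc : HasSum (fun p => c p ^ 2) (∫ x, f x ^ 2 ∂(gaussianReal 0 1)) := by
    have h := hermiteBasis.hasSum_inner_mul_inner F F
    rw [L2_inner_toLp] at h
    simp only [coe_hermiteBasis] at h
    have e : ∀ p, inner ℝ F (hermiteLp p) * inner ℝ (hermiteLp p) F = c p ^ 2 := fun p => by
      rw [hc, real_inner_comm F, sq]
    simp only [e] at h
    simpa only [sq (f _)] using h
  rw [← e1, ← hUV.tsum_eq, ← hcc.tsum_eq, ← tsum_mul_left]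
  have hle : ∀ p, |c p ^ 2 * ρ ^ p| ≤ |ρ| ^ k * c p ^ 2 := by
    intro p
    rcases lt_or_ge p k with h | h
    · simp [hc0 p h]
    · rw [abs_mul, abs_pow ρ, abs_of_nonneg (sq_nonneg (c p)), mul_comm]
      gcongr ?_ * _
      exact pow_le_pow_of_le_one (abs_nonneg _) hρ h
  have hs2 : Summable fun p => |ρ| ^ k * c p ^ 2 := hcc.summable.mul_left _
  exact tsum_of_norm_bounded (f := fun p => c p ^ 2 * ρ ^ p) hs2.hasSum hle

/-! ### Rademacher-Menshov inequalities -/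

/-- The weighted bound `2ab ≤ a²/K + K b²` makes the constant grow by one, instead of doubling, at
each dyadic level. -/
lemma sq_add_le_of_sq_le {a b B K : ℝ} (hK : 0 ≤ K) (hB : 0 ≤ B) (h : a ^ 2 ≤ K * B) :
    (a + b) ^ 2 ≤ (K + 1) * (B + b ^ 2) := by
  rcases hK.eq_or_lt with rfl | hK
  · have : a = 0 := by nlinarith [sq_nonneg a]
    subst this; simp; linarith
  · have h1 : 2 * a * b ≤ a ^ 2 / K + K * b ^ 2 := by
      have : a ^ 2 / K + K * b ^ 2 - 2 * a * b = (a - K * b) ^ 2 / K := by field_simp; ring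
      have : 0 ≤ (a - K * b) ^ 2 / K := by positivity
      linarith
    have h2 : a ^ 2 / K ≤ B := by rw [div_le_iff₀ hK]; linarith
    nlinarith

lemma sum_Ico_two_mul (f : ℕ → ℝ) (a b : ℕ) :
    ∑ u ∈ Finset.Ico a b, (f (2 * u) + f (2 * u + 1)) = ∑ u ∈ Finset.Ico (2 * a) (2 * b), f u := by
  rcases le_total b a with h | h
  · rw [Finset.Ico_eq_empty_of_le h, Finset.Ico_eq_empty_of_le (by lia)]; simp
  · induction b, h using Nat.le_induction with
    | base => simp
    | succ b hab ih =>
      rw [Finset.sum_Ico_succ_top hab, ih, show 2 * (b + 1) = 2 * b + 1 + 1 by ring,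
        Finset.sum_Ico_succ_top (by lia), Finset.sum_Ico_succ_top (by lia), add_assoc]

/-- The Rademacher-Menshov inequality: partial sums are controlled by dyadic block sums. -/
lemma sq_sum_range_le_dyadic (K : ℕ) (f : ℕ → ℝ) (l : ℕ) (hl : l < 2 ^ K) :
    (∑ u ∈ Finset.range l, f u) ^ 2 ≤ K * ∑ r ∈ Finset.range K, ∑ j ∈ Finset.range (2 ^ (K - r)),
      (∑ u ∈ Finset.Ico (j * 2 ^ r) ((j + 1) * 2 ^ r), f u) ^ 2 := by
  induction K generalizing f l with
  | zero => simp at hl; subst hl; simp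
  | succ K ih =>
    have hl2 : l / 2 < 2 ^ K := by rw [pow_succ] at hl; lia
    -- Pairing consecutive terms shifts the dyadic levels by one; for odd `l` the unpaired last term
    -- is absorbed by level zero.
    have h := ih (fun u => f (2 * u) + f (2 * u + 1)) (l / 2) hl2
    simp only [sum_Ico_two_mul] at h
    rw [Finset.range_eq_Ico, sum_Ico_two_mul, mul_zero, ← Finset.range_eq_Ico] at h
    rw [Finset.sum_range_succ']
    set B := ∑ r ∈ Finset.range K, ∑ j ∈ Finset.range (2 ^ (K - r)),
      (∑ u ∈ Finset.Ico (2 * (j * 2 ^ r)) (2 * ((j + 1) * 2 ^ r)), f u) ^ 2 with hB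
    have hB0 : 0 ≤ B := Finset.sum_nonneg fun r _ => Finset.sum_nonneg fun j _ => sq_nonneg _
    have hBe : ∑ r ∈ Finset.range K, ∑ j ∈ Finset.range (2 ^ (K + 1 - (r + 1))),
        (∑ u ∈ Finset.Ico (j * 2 ^ (r + 1)) ((j + 1) * 2 ^ (r + 1)), f u) ^ 2 = B := by
      refine Finset.sum_congr rfl fun r _ => ?_
      rw [Nat.add_sub_add_right]
      refine Finset.sum_congr rfl fun j _ => ?_
      rw [show j * 2 ^ (r + 1) = 2 * (j * 2 ^ r) by ring,
        show (j + 1) * 2 ^ (r + 1) = 2 * ((j + 1) * 2 ^ r) by ring]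
    rw [hBe]
    simp only [pow_zero, mul_one, Nat.Ico_succ_singleton, Finset.sum_singleton, Nat.sub_zero]
    push_cast
    obtain ⟨b, hb, hbs⟩ : ∃ b, ∑ u ∈ Finset.range l, f u = ∑ u ∈ Finset.range (2 * (l / 2)), f u + b ∧
        b ^ 2 ≤ ∑ j ∈ Finset.range (2 ^ (K + 1)), f j ^ 2 := by
      rcases Nat.mod_two_eq_zero_or_one l with hm | hm
      · refine ⟨0, by rw [show 2 * (l / 2) = l by lia, add_zero], ?_⟩
        rw [zero_pow two_ne_zero]; exact Finset.sum_nonneg fun j _ => sq_nonneg _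
      · refine ⟨f (2 * (l / 2)), by rw [← Finset.sum_range_succ, show 2 * (l / 2) + 1 = l by lia], ?_⟩
        exact Finset.single_le_sum (f := fun j => f j ^ 2) (fun j _ => sq_nonneg _)
          (Finset.mem_range.2 (by lia))
    rw [hb]
    refine (sq_add_le_of_sq_le (Nat.cast_nonneg K) hB0 h).trans ?_
    gcongr

/-- Two-parameter Rademacher-Menshov inequality. -/
lemma sq_sum_sum_range_le_dyadic (K : ℕ) (a : ℕ → ℕ → ℝ) (l i : ℕ) (hl : l < 2 ^ K)
    (hi : i < 2 ^ K) :
    (∑ u ∈ Finset.range l, ∑ v ∈ Finset.range i, a u v) ^ 2 ≤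
      (K : ℝ) ^ 2 * ∑ r ∈ Finset.range K, ∑ j ∈ Finset.range (2 ^ (K - r)),
        ∑ s ∈ Finset.range K, ∑ k ∈ Finset.range (2 ^ (K - s)),
          (∑ u ∈ Finset.Ico (j * 2 ^ r) ((j + 1) * 2 ^ r),
            ∑ v ∈ Finset.Ico (k * 2 ^ s) ((k + 1) * 2 ^ s), a u v) ^ 2 := by
  refine (sq_sum_range_le_dyadic K _ l hl).trans ?_
  rw [sq (K : ℝ), mul_assoc]
  refine mul_le_mul_of_nonneg_left ?_ (Nat.cast_nonneg K)
  rw [Finset.mul_sum]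
  refine Finset.sum_le_sum fun r _ => ?_
  rw [Finset.mul_sum]
  refine Finset.sum_le_sum fun j _ => ?_
  rw [Finset.sum_comm]
  refine (sq_sum_range_le_dyadic K _ i hi).trans_eq ?_
  congr 1
  refine Finset.sum_congr rfl fun s _ => Finset.sum_congr rfl fun k _ => ?_
  rw [Finset.sum_comm]

/-! ### Chains of half-lines -/

/-- Inner regularity, for sets that are unions of infinitely many half-lines: a compact subset
contains its extreme points and therefore lies in a single half-line. -/
lemma measureReal_le_of_forall_isCompact {μ : Measure ℝ} [IsFiniteMeasure μ] {S : Set ℝ}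
    (hS : MeasurableSet S) {c : ℝ} (hc : 0 ≤ c)
    (h : ∀ K ⊆ S, IsCompact K → K.Nonempty → μ.real K ≤ c) : μ.real S ≤ c := by
  refine ENNReal.toReal_le_of_le_ofReal hc ?_
  rw [hS.measure_eq_iSup_isCompact]
  refine iSup_le fun K => iSup_le fun hKS => iSup_le fun hK => ?_
  rcases K.eq_empty_or_nonempty with rfl | hne
  · simp
  · rw [← ENNReal.ofReal_toReal (measure_ne_top μ K)]
    exact ENNReal.ofReal_le_ofReal (h K hKS hK hne)

/-- A finite measure on the line admits a chain of sets such that every half-line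
`(-∞, x]` lies between two consecutive ones whose difference has small measure. -/
lemma exists_chain_Iic (μ : Measure ℝ) [IsFiniteMeasure μ] (N : ℕ) (hN : 0 < N) :
    ∃ W : ℕ → Set ℝ, Monotone W ∧ (∀ j, MeasurableSet (W j)) ∧ ∀ x : ℝ, ∃ i ≤ N,
      W (2 * i) ⊆ Set.Iic x ∧ Set.Iic x ⊆ W (2 * i + 1) ∧
        μ.real (W (2 * i + 1) \ W (2 * i)) ≤ μ.real Set.univ / N := by
  set T := μ.real Set.univ
  set F : ℝ → ℝ := fun x => μ.real (Set.Iic x)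
  let c : ℝ → ℕ := fun x => ⌊F x * N / T⌋₊
  have hN' : (0 : ℝ) < N := by exact_mod_cast hN
  have hT : 0 ≤ T := measureReal_nonneg
  have hFT : ∀ x, F x ≤ T := fun x => measureReal_mono (Set.subset_univ _)
  have hF0 : ∀ x, 0 ≤ F x := fun x => measureReal_nonneg
  have hc : Monotone c := fun x y hxy => Nat.floor_mono (by
    have : F x ≤ F y := measureReal_mono (Set.Iic_subset_Iic.2 hxy)
    gcongr)
  have hcN : ∀ x, c x ≤ N := fun x => Nat.floor_le_of_le (by
    rcases hT.eq_or_lt with h | h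
    · rw [← h]; simp
    · rw [div_le_iff₀ h, mul_comm]; gcongr; exact hFT x)
  have hup : ∀ x i, c x ≤ i → F x ≤ (i + 1) * (T / N) := by
    intro x i hi
    rcases hT.eq_or_lt with h | h
    · have := hFT x; rw [← h] at this ⊢; simpa using this
    · have h1 : F x * N / T < i + 1 := by
        have := Nat.lt_floor_add_one (F x * N / T)
        have h2 : (⌊F x * N / T⌋₊ : ℝ) ≤ i := by exact_mod_cast hi
        linarith
      rw [div_lt_iff₀ h] at h1
      rw [← mul_div_assoc, le_div_iff₀ hN']; exact h1.le
  have hlow : ∀ x i, i ≤ c x → i * (T / N) ≤ F x := by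
    intro x i hi
    rcases hT.eq_or_lt with h | h
    · rw [← h]; simpa using hF0 x
    · have h1 : (i : ℝ) ≤ F x * N / T :=
        (by exact_mod_cast hi : (i : ℝ) ≤ c x).trans (Nat.floor_le (by have := hF0 x; positivity))
      rw [le_div_iff₀ h] at h1
      rw [← mul_div_assoc, div_le_iff₀ hN']; exact h1
  -- `c` is the distribution function rounded down in steps of `T / N`. `U i` is the union of the
  -- half-lines of level at most `i`, `V i` the intersection of those of level at least `i`, and
  -- they bracket the half-lines of level `i`. An atom heavier than `T / N` makes `c` jump and falls
  -- outside every bracket. If no half-line has level `i`, `V i` may exceed `U i`; the intersection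
  -- in `W` restores monotonicity.
  let U : ℕ → Set ℝ := fun i => {y | ∃ x, c x ≤ i ∧ y ≤ x}
  let V : ℕ → Set ℝ := fun i => {y | ∀ x, i ≤ c x → y ≤ x}
  have hUl : ∀ i, IsLowerSet (U i) := fun i a b hba ⟨x, hx, hax⟩ => ⟨x, hx, hba.trans hax⟩
  have hVl : ∀ i, IsLowerSet (V i) := fun i a b hba h x hx => hba.trans (h x hx)
  have hUm : ∀ i, MeasurableSet (U i) := fun i => (hUl i).ordConnected.measurableSet
  have hVm : ∀ i, MeasurableSet (V i) := fun i => (hVl i).ordConnected.measurableSet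
  have hUV : ∀ i j, i < j → U i ⊆ V j := fun i j hij y ⟨x, hx, hyx⟩ z hz =>
    hyx.trans (hc.reflect_lt (hx.trans_lt (hij.trans_le hz))).le
  have hUmono : Monotone U := fun i j hij y ⟨x, hx, hyx⟩ => ⟨x, hx.trans hij, hyx⟩
  let W : ℕ → Set ℝ := fun j => if j % 2 = 0 then U (j / 2) ∩ V (j / 2) else U (j / 2)
  have hW0 : ∀ i, W (2 * i) = U i ∩ V i := fun i => by simp [W]
  have hW1 : ∀ i, W (2 * i + 1) = U i := fun i => by
    simp only [W, show (2 * i + 1) % 2 = 1 by lia, show (2 * i + 1) / 2 = i by lia]; simp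
  refine ⟨W, monotone_nat_of_le_succ fun j => ?_, fun j => ?_, fun x => ⟨c x, hcN x, ?_, ?_, ?_⟩⟩
  · rcases Nat.even_or_odd' j with ⟨i, rfl | rfl⟩
    · rw [hW0, hW1]; exact Set.inter_subset_left
    · rw [hW1, show 2 * i + 1 + 1 = 2 * (i + 1) by ring, hW0]
      exact Set.subset_inter (hUmono (by simp)) (hUV _ _ (by simp))
  · simp only [W]; split_ifs
    exacts [(hUm _).inter (hVm _), hUm _]
  · rw [hW0]; exact fun y hy => hy.2 x le_rfl
  · rw [hW1]; exact fun y hy => ⟨x, le_rfl, hy⟩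
  · set i := c x
    have hVU : V i ⊆ U i := fun y hy => ⟨x, le_rfl, hy x le_rfl⟩
    rw [hW0, hW1, Set.inter_eq_right.2 hVU, measureReal_sdiff hVU (hVm i)]
    have h1 : μ.real (U i) ≤ (i + 1) * (T / N) := by
      refine measureReal_le_of_forall_isCompact (hUm i) (by positivity) fun K hKU hK hne => ?_
      obtain ⟨z, hz, hKz⟩ := hKU (hK.sSup_mem hne)
      refine le_trans (measureReal_mono fun y hy => ?_) (hup z i hz)
      exact (le_csSup hK.bddAbove hy).trans hKz
    have h2 : μ.real (V i)ᶜ ≤ T - i * (T / N) := by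
      refine measureReal_le_of_forall_isCompact (hVm i).compl
        (sub_nonneg.2 ((hlow x i le_rfl).trans (hFT x))) fun K hKV hK hne => ?_
      have h := hKV (hK.sInf_mem hne)
      simp only [V, Set.mem_compl_iff, Set.mem_ofPred_eq, not_forall, not_le] at h
      obtain ⟨z, hz, hzK⟩ := h
      have h3 : μ.real K ≤ μ.real (Set.Iic z)ᶜ := measureReal_mono fun y hy => by
        simpa using hzK.trans_le (csInf_le hK.bddBelow hy)
      rw [measureReal_compl measurableSet_Iic] at h3
      have := hlow z i hz
      exact h3.trans (by simp only [F] at this; linarith)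
    rw [measureReal_compl (hVm i)] at h2
    linarith

/-! ### Slowly varying functions -/

/-- A weak form of Egorov's theorem: by pointwise convergence these increasing sets exhaust the
interval. -/
lemma tendsto_volume_inter_forall_ge {f : ℕ → ℝ → ℝ}
    (h : ∀ v, Tendsto (fun n => f n v) atTop (𝓝 0)) {ε : ℝ} (hε : 0 < ε) (b : ℝ) :
    Tendsto (fun n => volume.real (Set.Icc 0 b ∩ {v | ∀ j ≥ n, |f j v| < ε})) atTop
      (𝓝 (volume.real (Set.Icc 0 b))) := by
  have hmono : Monotone fun n => Set.Icc 0 b ∩ {v | ∀ j ≥ n, |f j v| < ε} :=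
    fun n m hnm v hv => ⟨hv.1, fun j hj => hv.2 j (hnm.trans hj)⟩
  have hU : ⋃ n, Set.Icc 0 b ∩ {v | ∀ j ≥ n, |f j v| < ε} = Set.Icc 0 b := by
    rw [← Set.inter_iUnion, Set.inter_eq_left]
    intro v _
    obtain ⟨n, hn⟩ := Metric.tendsto_atTop.1 (h v) ε hε
    exact Set.mem_iUnion.2 ⟨n, fun j hj => by simpa using hn j hj⟩
  have ht := tendsto_measure_iUnion_atTop (μ := volume) hmono
  rw [hU] at ht
  exact (ENNReal.tendsto_toReal (by simp)).comp ht

/-- The uniform convergence theorem for slowly varying functions, in additive form. -/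
lemma exists_forall_abs_sub_le_of_tendsto {h : ℝ → ℝ} (hm : Measurable h)
    (hh : ∀ u, Tendsto (fun x => h (x + u) - h x) atTop (𝓝 0)) {ε : ℝ} (hε : 0 < ε) :
    ∃ x₀, ∀ x ≥ x₀, ∀ u ∈ Set.Icc (0 : ℝ) 1, |h (x + u) - h x| ≤ ε := by
  by_contra! hcon
  choose x hx u hu hxu using fun n : ℕ => hcon n
  have hxt : Tendsto x atTop atTop := tendsto_atTop_mono hx tendsto_natCast_atTop_atTop
  have hyt : Tendsto (fun n => x n + u n) atTop atTop :=
    tendsto_atTop_mono (fun n => by linarith [(hu n).1]) hxt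
  have h1 := tendsto_volume_inter_forall_ge (f := fun n v => h (x n + v) - h (x n))
    (fun v => (hh v).comp hxt) (half_pos hε) 3
  have h2 := tendsto_volume_inter_forall_ge (f := fun n v => h (x n + u n + v) - h (x n + u n))
    (fun v => (hh v).comp hyt) (half_pos hε) 2
  simp only [Real.volume_real_Icc, sub_zero] at h1 h2
  -- `A` and the translate of `B` by `u n` both lie in `[0, 3]`, and `5/2 + 3/2 > 3` forces them to
  -- meet. At a common point the increments from `x n` and from `x n + u n` are both below `ε / 2`,
  -- against the choice of `u n`.
  obtain ⟨n, hn1, hn2⟩ := ((h1.eventually_const_lt (u := 5 / 2) (by norm_num)).and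
    (h2.eventually_const_lt (u := 3 / 2) (by norm_num))).exists
  set A := Set.Icc (0 : ℝ) 3 ∩ {v | ∀ j ≥ n, |h (x j + v) - h (x j)| < ε / 2}
  set B := Set.Icc (0 : ℝ) 2 ∩ {v | ∀ j ≥ n, |h (x j + u j + v) - h (x j + u j)| < ε / 2} with hB
  have hBm : MeasurableSet B := by
    refine measurableSet_Icc.inter ?_
    simp only [Set.ofPred_forall]
    refine MeasurableSet.iInter fun j => MeasurableSet.iInter fun _ => ?_
    exact measurableSet_lt (by fun_prop) measurable_const
  have hB' : volume.real ((fun v => v + -u n) ⁻¹' B) = volume.real B := by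
    simp only [Measure.real]
    rw [measure_preimage_add_right]
  have hAB : ¬ Disjoint A ((fun v => v + -u n) ⁻¹' B) := by
    intro hd
    have hs : A ∪ ((fun v => v + -u n) ⁻¹' B) ⊆ Set.Icc 0 3 := by
      rintro v (hv | hv)
      · exact hv.1
      · have := hv.1; have := hu n
        simp only [Set.mem_Icc] at *
        constructor <;> linarith
    have h3 := measureReal_mono (μ := volume) hs (by simp)
    rw [measureReal_union hd (hBm.preimage (by fun_prop))
      (by exact ((measure_mono Set.inter_subset_left).trans_lt (by simp)).ne)
      (by rw [measure_preimage_add_right]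
          exact ((measure_mono Set.inter_subset_left).trans_lt (by simp)).ne), hB'] at h3
    simp only [Real.volume_real_Icc] at h3
    norm_num at h3
    linarith
  obtain ⟨v, hvA, hvB⟩ := Set.not_disjoint_iff.1 hAB
  have e1 := hvA.2 n le_rfl
  have e2 := hvB.2 n le_rfl
  have e3 := hxu n
  rw [show x n + u n + (v + -u n) = x n + v by ring] at e2
  have : h (x n + u n) - h (x n) = (h (x n + v) - h (x n)) - (h (x n + v) - h (x n + u n)) := by ring
  rw [this] at e3
  linarith [abs_sub (h (x n + v) - h (x n)) (h (x n + v) - h (x n + u n))]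

/-- Unit steps beyond `x₀` change `h` by at most `δ / 2` each, by uniform convergence; the other `δ
/ 2` of the slope absorbs the constants for large `x`. -/
lemma exists_forall_abs_le_mul_of_tendsto {h : ℝ → ℝ} (hm : Measurable h)
    (hh : ∀ u, Tendsto (fun x => h (x + u) - h x) atTop (𝓝 0)) {δ : ℝ} (hδ : 0 < δ) :
    ∀ᶠ x in atTop, |h x| ≤ δ * x := by
  obtain ⟨x₀, hx₀⟩ := exists_forall_abs_sub_le_of_tendsto hm hh (half_pos hδ)
  have step : ∀ k : ℕ, |h (x₀ + k) - h x₀| ≤ k * (δ / 2) := by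
    intro k
    induction k with
    | zero => simp
    | succ k ih =>
      have h1 := hx₀ (x₀ + k) (by simp) 1 (by simp)
      have : h (x₀ + (k + 1 : ℕ)) - h x₀ =
          (h (x₀ + k + 1) - h (x₀ + k)) + (h (x₀ + k) - h x₀) := by push_cast; ring_nf
      rw [this]; push_cast
      linarith [abs_add_le (h (x₀ + k + 1) - h (x₀ + k)) (h (x₀ + k) - h x₀)]
  filter_upwards [eventually_ge_atTop x₀,
    eventually_ge_atTop (2 / δ * (|h x₀| + δ / 2 - x₀ * (δ / 2)))] with x hx hx2
  have hk := Nat.floor_le (sub_nonneg.2 hx)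
  have hk2 := Nat.lt_floor_add_one (x - x₀)
  set k := ⌊x - x₀⌋₊
  have h1 := hx₀ (x₀ + k) (by simp) (x - x₀ - k) ⟨by linarith, by linarith⟩
  rw [show x₀ + k + (x - x₀ - k) = x by ring] at h1
  have h2 := step k
  have h3 : |h x| ≤ δ / 2 + k * (δ / 2) + |h x₀| := by
    have : h x = (h x - h (x₀ + k)) + (h (x₀ + k) - h x₀) + h x₀ := by ring
    rw [this]
    refine (abs_add_le _ _).trans (add_le_add ((abs_add_le _ _).trans (add_le_add h1 h2)) le_rfl)
  have h4 : k * (δ / 2) ≤ (x - x₀) * (δ / 2) := by gcongr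
  have h5 : |h x₀| + δ / 2 - x₀ * (δ / 2) ≤ x * (δ / 2) := by
    rw [div_mul_eq_mul_div, div_le_iff₀ hδ] at hx2
    linarith
  linarith

/-- Slowly varying functions grow and decay slower than any power. -/
lemma IsSlowlyVarying.eventually_rpow_le {L : ℝ → ℝ} (hL : IsSlowlyVarying L) {δ : ℝ}
    (hδ : 0 < δ) : ∀ᶠ x in atTop, x ^ (-δ) ≤ L x ∧ L x ≤ x ^ δ := by
  have hm : Measurable fun x => Real.log (L (Real.exp x)) := by
    have := hL.measurable; fun_prop
  have hpos := Real.tendsto_exp_atTop.eventually hL.eventually_pos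
  have hh : ∀ u, Tendsto (fun x => Real.log (L (Real.exp (x + u))) - Real.log (L (Real.exp x)))
      atTop (𝓝 0) := by
    intro u
    have h1 := (hL.tendsto_ratio (Real.exp u) (Real.exp_pos u)).comp Real.tendsto_exp_atTop
    have h2 := (Real.continuousAt_log one_ne_zero).tendsto.comp h1
    rw [Real.log_one] at h2
    have hpos' := (tendsto_atTop_add_const_right atTop u tendsto_id).eventually hpos
    refine h2.congr' ?_
    filter_upwards [hpos, hpos'] with x hx hx'
    simp only [Function.comp, id] at hx' ⊢
    rw [Real.log_div (by rw [← Real.exp_add, add_comm]; exact hx'.ne') hx.ne', ← Real.exp_add,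
      add_comm u]
  have h := Real.tendsto_log_atTop.eventually (exists_forall_abs_le_mul_of_tendsto hm hh hδ)
  filter_upwards [h, hL.eventually_pos, eventually_gt_atTop 0] with x hx hLx hx0
  rw [Real.exp_log hx0, abs_le] at hx
  rw [Real.rpow_def_of_pos hx0, Real.rpow_def_of_pos hx0]
  constructor
  · rw [← Real.le_log_iff_exp_le hLx]; linarith
  · rw [← Real.log_le_iff_le_exp hLx]; linarith

/-! ### Single and double sums of power-like sequences -/

/-- Each distance from `i` occurs at most once on either side of `i`. -/
lemma sum_Ico_dist_le {w : ℕ → ℝ} (hw : ∀ k, 0 ≤ w k) {a b M : ℕ} (h : b ≤ a + M) {i : ℕ}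
    (hi : i ∈ Finset.Ico a b) :
    ∑ j ∈ Finset.Ico a b, w (Nat.dist i j) ≤ 2 * ∑ k ∈ Finset.range M, w k := by
  have key : ∀ (S : Finset ℕ), Set.InjOn (fun j => Nat.dist i j) S →
      (∀ j ∈ S, Nat.dist i j < M) → ∑ j ∈ S, w (Nat.dist i j) ≤ ∑ k ∈ Finset.range M, w k := by
    intro S hS hM
    rw [← Finset.sum_image (f := w) hS]
    refine Finset.sum_le_sum_of_subset_of_nonneg (fun k hk => ?_) fun k _ _ => hw k
    obtain ⟨j, hj, rfl⟩ := Finset.mem_image.1 hk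
    exact Finset.mem_range.2 (hM j hj)
  rw [Finset.mem_Ico] at hi
  rw [← Finset.sum_Ico_consecutive _ hi.1 hi.2.le, two_mul]
  refine add_le_add (key _ ?_ ?_) (key _ ?_ ?_)
  · intro x hx y hy hxy
    simp only [Finset.coe_Ico, Set.mem_Ico, Nat.dist] at hx hy hxy
    lia
  · intro j hj
    simp only [Finset.mem_Ico, Nat.dist] at hj ⊢
    lia
  · intro x hx y hy hxy
    simp only [Finset.coe_Ico, Set.mem_Ico, Nat.dist] at hx hy hxy
    lia
  · intro j hj
    simp only [Finset.mem_Ico, Nat.dist] at hj ⊢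
    lia

lemma sum_sum_Ico_dist_le {w : ℕ → ℝ} (hw : ∀ k, 0 ≤ w k) {a b M : ℕ} (h : b ≤ a + M) :
    ∑ i ∈ Finset.Ico a b, ∑ j ∈ Finset.Ico a b, w (Nat.dist i j) ≤
      (b - a : ℕ) * (2 * ∑ k ∈ Finset.range M, w k) := by
  refine (Finset.sum_le_sum fun i hi => sum_Ico_dist_le hw h hi).trans_eq ?_
  rw [Finset.sum_const, Nat.card_Ico, nsmul_eq_mul]

/-- Bernoulli's inequality for the exponent `1 - β ≤ 1` at `s = -1 / (M + 1)` shows that the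
increment of `M ^ (1 - β)` is at least `(1 - β) * (M + 1) ^ (-β)`. -/
lemma sum_range_rpow_neg_le {β : ℝ} (h0 : 0 ≤ β) (h1 : β < 1) (M : ℕ) :
    ∑ k ∈ Finset.range M, ((k : ℝ) + 1) ^ (-β) ≤ (M : ℝ) ^ (1 - β) / (1 - β) := by
  have hb : 0 < 1 - β := by linarith
  induction M with
  | zero => simp [Real.zero_rpow hb.ne']
  | succ M ih =>
    rw [Finset.sum_range_succ]
    have hM : (0 : ℝ) < M + 1 := by positivity
    have h2 := rpow_one_add_le_one_add_mul_self (s := -(1 / ((M : ℝ) + 1))) (p := 1 - β)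
      (by rw [neg_le_neg_iff, div_le_one hM]; simp) hb.le (by linarith)
    have h3 : (M : ℝ) = (M + 1) * (1 + -(1 / ((M : ℝ) + 1))) := by field_simp; ring
    have h4 : (M : ℝ) ^ (1 - β) = (M + 1 : ℝ) ^ (1 - β) * (1 + -(1 / ((M : ℝ) + 1))) ^ (1 - β) := by
      conv_lhs => rw [h3]
      refine Real.mul_rpow hM.le ?_
      have : 1 / ((M : ℝ) + 1) ≤ 1 := by rw [div_le_one hM]; simp
      linarith
    have h5 : (M + 1 : ℝ) ^ (-β) = (M + 1 : ℝ) ^ (1 - β) / (M + 1) := by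
      rw [← Real.rpow_sub_one hM.ne']; ring_nf
    have h6 : (M : ℝ) ^ (1 - β) ≤ (M + 1 : ℝ) ^ (1 - β) - (1 - β) * (M + 1 : ℝ) ^ (-β) := by
      rw [h4, h5]
      calc _ ≤ (M + 1 : ℝ) ^ (1 - β) * (1 + (1 - β) * -(1 / ((M : ℝ) + 1))) := by gcongr
        _ = _ := by ring
    have h7 : (M : ℝ) ^ (1 - β) / (1 - β) ≤
        (M + 1 : ℝ) ^ (1 - β) / (1 - β) - (M + 1 : ℝ) ^ (-β) := by
      rw [div_le_iff₀ hb, sub_mul, div_mul_cancel₀ _ hb.ne']; linarith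
    push_cast
    linarith

/-- Partial sums of a bounded sequence which is eventually at most `k ^ (-β)`. -/
lemma exists_sum_range_le_rpow {w : ℕ → ℝ} (hw : ∀ k, w k ≤ 1) {β : ℝ} (h0 : 0 ≤ β) (h1 : β < 1)
    (h : ∀ᶠ k : ℕ in atTop, w k ≤ (k : ℝ) ^ (-β)) :
    ∃ C, 0 < C ∧ ∀ M : ℕ, ∑ k ∈ Finset.range M, w k ≤ C * (M : ℝ) ^ (1 - β) := by
  obtain ⟨k₀, hk₀⟩ := eventually_atTop.1 h
  -- One constant for both ranges: it exceeds `(k + 1) ^ β` for `k ≤ k₀`, where `w k ≤ 1`, and `((k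
  -- + 1) / k) ^ β` for larger `k`.
  set C := ((k₀ : ℝ) + 2) ^ β
  have hb : 0 < 1 - β := by linarith
  have hk : ∀ k, w k ≤ C * ((k : ℝ) + 1) ^ (-β) := by
    intro k
    have hk1 : (0 : ℝ) < k + 1 := by positivity
    rcases lt_or_ge k (k₀ + 1) with hlt | hge
    · refine (hw k).trans ?_
      rw [Real.rpow_neg hk1.le, ← div_eq_mul_inv, ← Real.div_rpow (by positivity) hk1.le]
      refine Real.one_le_rpow ?_ h0
      rw [one_le_div hk1]
      have : (k : ℝ) ≤ k₀ := by exact_mod_cast Nat.lt_succ_iff.1 hlt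
      linarith
    · refine (hk₀ k (by lia)).trans ?_
      have hk0 : (1 : ℝ) ≤ k := by exact_mod_cast (by lia : 1 ≤ k)
      rw [Real.rpow_neg (by positivity), Real.rpow_neg hk1.le, ← div_eq_mul_inv,
        ← Real.div_rpow (by positivity) hk1.le, ← Real.inv_rpow (by positivity)]
      refine Real.rpow_le_rpow (by positivity) ?_ h0
      rw [inv_eq_one_div, div_le_div_iff₀ (by positivity) hk1]
      have : (0 : ℝ) ≤ k₀ := by positivity
      nlinarith
  refine ⟨C / (1 - β), by positivity, fun M => ?_⟩
  refine (Finset.sum_le_sum fun k _ => hk k).trans ?_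
  rw [← Finset.mul_sum, div_mul_eq_mul_div, mul_div_assoc]
  exact mul_le_mul_of_nonneg_left (sum_range_rpow_neg_le h0 h1 M) (by positivity)

/-- Double sums of a sequence which is at least `-1` and eventually at least `k ^ (-α)`. -/
lemma eventually_le_sum_sum_dist {w : ℕ → ℝ} (hw : ∀ k, -1 ≤ w k) {α : ℝ} (h0 : 0 ≤ α) (h1 : α < 1)
    (h : ∀ᶠ k : ℕ in atTop, (k : ℝ) ^ (-α) ≤ w k) :
    ∀ᶠ n : ℕ in atTop, (n : ℝ) ^ (2 - α) / 2 ≤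
      ∑ i ∈ Finset.range n, ∑ j ∈ Finset.range n, w (Nat.dist i j) := by
  obtain ⟨k₀, hk₀⟩ := eventually_atTop.1 h
  have ht : Tendsto (fun n : ℕ => (n : ℝ) ^ (1 - α)) atTop atTop :=
    (tendsto_rpow_atTop (by linarith)).comp tendsto_natCast_atTop_atTop
  filter_upwards [ht.eventually_ge_atTop (8 * ((k₀ : ℝ) + 1)), eventually_ge_atTop 1] with n hn hn1
  have hn' : (1 : ℝ) ≤ n := by exact_mod_cast hn1
  have hn0 : (0 : ℝ) < n := by linarith
  -- `g` marks the short distances, where only `w ≥ -1 ≥ n ^ (-α) - 2` is known. Such pairs cost at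
  -- most `4 n (k₀ + 1)` in total, half of the main term `n ^ (2 - α)` by the choice of `n`.
  let g : ℕ → ℝ := fun k => if k < k₀ + 1 then 1 else 0
  have hg : ∀ k, 0 ≤ g k := fun k => by simp only [g]; split_ifs <;> norm_num
  have hp : ∀ i ∈ Finset.range n, ∀ j ∈ Finset.range n,
      (n : ℝ) ^ (-α) - 2 * g (Nat.dist i j) ≤ w (Nat.dist i j) := by
    intro i hi j hj
    rw [Finset.mem_range] at hi hj
    have hd : Nat.dist i j ≤ n := by simp only [Nat.dist]; lia
    set k := Nat.dist i j
    by_cases hk : k < k₀ + 1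
    · have : (n : ℝ) ^ (-α) ≤ 1 := Real.rpow_le_one_of_one_le_of_nonpos hn' (by linarith)
      simp only [g, hk, if_true]
      linarith [hw k]
    · simp only [g, hk, if_false, mul_zero, sub_zero]
      refine le_trans ?_ (hk₀ k (by lia))
      exact Real.rpow_le_rpow_of_nonpos (by exact_mod_cast (by lia : 0 < k)) (by exact_mod_cast hd)
        (by linarith)
  have hgs := sum_sum_Ico_dist_le hg (a := 0) (b := n) (M := n) (by lia)
  rw [← Finset.range_eq_Ico] at hgs
  have hgk : ∑ k ∈ Finset.range n, g k ≤ k₀ + 1 := by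
    simp only [g]
    rw [← Finset.sum_filter, Finset.sum_const, nsmul_eq_mul, mul_one]
    have : (Finset.range n).filter (· < k₀ + 1) ⊆ Finset.range (k₀ + 1) := fun k hk => by
      simpa using (Finset.mem_filter.1 hk).2
    exact_mod_cast (Finset.card_le_card this).trans_eq (Finset.card_range _)
  refine le_trans ?_ (Finset.sum_le_sum fun i hi => Finset.sum_le_sum fun j hj => hp i hi j hj)
  simp only [Finset.sum_sub_distrib, Finset.sum_const, Finset.card_range, nsmul_eq_mul,
    ← Finset.mul_sum]
  have e1 : (n : ℝ) ^ (2 - α) = n * (n : ℝ) ^ (1 - α) := by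
    rw [mul_comm, ← Real.rpow_add_one hn0.ne']; ring_nf
  have e2 : (n : ℝ) ^ (1 - α) = n * (n : ℝ) ^ (-α) := by
    rw [mul_comm, ← Real.rpow_add_one hn0.ne']; ring_nf
  rw [← e2, ← e1]
  simp only [Nat.sub_zero] at hgs
  have h3 : (n : ℝ) * (2 * ∑ k ∈ Finset.range n, g k) ≤ n * (2 * (k₀ + 1)) := by gcongr
  have h4 : (n : ℝ) * (8 * (k₀ + 1)) ≤ (n : ℝ) ^ (2 - α) := by rw [e1]; gcongr
  linarith

/-- Lets the factor `K ^ 4` of the chaining bound, logarithmic in `n`, be absorbed by an arbitrarily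
small power. -/
lemma exists_natCast_le_rpow_two_pow {η : ℝ} (hη : 0 < η) :
    ∃ C, 0 < C ∧ ∀ K : ℕ, (K : ℝ) ≤ C * ((2 : ℝ) ^ K) ^ η := by
  have h1 : 1 < (2 : ℝ) ^ η := Real.one_lt_rpow (by norm_num) hη
  refine ⟨((2 : ℝ) ^ η - 1)⁻¹, inv_pos.2 (by linarith), fun K => ?_⟩
  have h2 := one_add_mul_sub_le_pow (a := (2 : ℝ) ^ η) (by linarith) K
  have h3 : ((2 : ℝ) ^ K) ^ η = ((2 : ℝ) ^ η) ^ K := by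
    rw [← Real.rpow_natCast, ← Real.rpow_natCast, ← Real.rpow_mul (by norm_num),
      ← Real.rpow_mul (by norm_num), mul_comm]
  rw [h3, ← div_eq_inv_mul, le_div_iff₀ (by linarith)]
  linarith

/-! ### Second moments of reduced indicators -/

/-- The Hermite coefficient of the indicator of a set. -/
noncomputable def setHermiteCoeff (q : ℕ) (B : Set ℝ) : ℝ :=
  ∫ x in B, hermiteFun q x ∂(gaussianReal 0 1)

/-- The indicator of a set minus its Hermite expansion up to order `m`. -/
noncomputable def reducedIndicator (m : ℕ) (B : Set ℝ) (y : ℝ) : ℝ :=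
  B.indicator 1 y -
    ∑ q ∈ Finset.range (m + 1), setHermiteCoeff q B / (q.factorial : ℝ) * hermiteFun q y

lemma integrable_hermiteFun (q : ℕ) : Integrable (hermiteFun q) (gaussianReal 0 1) :=
  (memLp_hermiteFun q).integrable (by norm_num)

lemma setHermiteCoeff_union (q : ℕ) {B C : Set ℝ} (hd : Disjoint B C) (hC : MeasurableSet C) :
    setHermiteCoeff q (B ∪ C) = setHermiteCoeff q B + setHermiteCoeff q C :=
  setIntegral_union hd hC (integrable_hermiteFun q).integrableOn
    (integrable_hermiteFun q).integrableOn

lemma reducedIndicator_empty (m : ℕ) (y : ℝ) : reducedIndicator m ∅ y = 0 := by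
  simp [reducedIndicator, setHermiteCoeff]

/-- Additivity in the set: increments along a chain are again reduced indicators, on which chaining
and bracketing both rest. -/
lemma reducedIndicator_diff (m : ℕ) {B C : Set ℝ} (h : B ⊆ C) (hB : MeasurableSet B)
    (hC : MeasurableSet C) (y : ℝ) :
    reducedIndicator m (C \ B) y = reducedIndicator m C y - reducedIndicator m B y := by
  have h1 : C = B ∪ (C \ B) := (Set.union_sdiff_cancel h).symm
  have h2 : ∀ q, setHermiteCoeff q C = setHermiteCoeff q B + setHermiteCoeff q (C \ B) := fun q => by
    rw [← setHermiteCoeff_union q Set.disjoint_sdiff_right (hC.diff hB), ← h1]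
  have h3 : C.indicator (1 : ℝ → ℝ) y = B.indicator 1 y + (C \ B).indicator 1 y := by
    conv_lhs => rw [h1]
    rw [Set.indicator_union_of_disjoint Set.disjoint_sdiff_right]
  simp only [reducedIndicator, h2, h3, add_div, add_mul, Finset.sum_add_distrib]
  ring

lemma memLp_indicator_one {B : Set ℝ} (hB : MeasurableSet B) :
    MemLp (B.indicator (1 : ℝ → ℝ)) 2 (gaussianReal 0 1) :=
  (memLp_const (1 : ℝ)).indicator hB

lemma memLp_reducedIndicator (m : ℕ) {B : Set ℝ} (hB : MeasurableSet B) :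
    MemLp (reducedIndicator m B) 2 (gaussianReal 0 1) :=
  (memLp_indicator_one hB).sub
    (memLp_finsetSum _ fun q _ => (memLp_hermiteFun q).const_mul _)

lemma integral_indicator_mul_hermiteFun {B : Set ℝ} (hB : MeasurableSet B) (q : ℕ) :
    ∫ x, B.indicator 1 x * hermiteFun q x ∂(gaussianReal 0 1) = setHermiteCoeff q B := by
  rw [setHermiteCoeff, ← integral_indicator hB]
  congr 1; ext x
  by_cases h : x ∈ B <;> simp [h]

lemma integral_hermiteFun_mul_hermiteFun_gaussianReal (p q : ℕ) :
    ∫ x, hermiteFun p x * hermiteFun q x ∂(gaussianReal 0 1) =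
      if p = q then (p.factorial : ℝ) else 0 := by
  have h := integral_hermiteFun_mul_hermiteFun (MeasurePreserving.id (gaussianReal 0 1))
    (MeasurePreserving.id (gaussianReal 0 1)) hasGaussianLaw_diag p q
  simpa [integral_mul_self_gaussianReal] using h

lemma integral_reducedIndicator_mul_hermiteFun {m : ℕ} {B : Set ℝ} (hB : MeasurableSet B)
    {q : ℕ} (hq : q < m + 1) :
    ∫ x, reducedIndicator m B x * hermiteFun q x ∂(gaussianReal 0 1) = 0 := by
  have h1 : Integrable (fun x => B.indicator 1 x * hermiteFun q x) (gaussianReal 0 1) :=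
    (memLp_indicator_one hB).integrable_mul (memLp_hermiteFun q)
  have h2 : ∀ p, Integrable (fun x => setHermiteCoeff p B / (p.factorial : ℝ) *
      (hermiteFun p x * hermiteFun q x)) (gaussianReal 0 1) := fun p =>
    ((memLp_hermiteFun p).integrable_mul (memLp_hermiteFun q)).const_mul _
  simp only [reducedIndicator, sub_mul, Finset.sum_mul, mul_assoc]
  rw [integral_sub h1 (integrable_finsetSum _ fun p _ => h2 p),
    integral_finsetSum _ fun p _ => h2 p, integral_indicator_mul_hermiteFun hB]
  simp only [integral_const_mul, integral_hermiteFun_mul_hermiteFun_gaussianReal, mul_ite, mul_zero]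
  rw [Finset.sum_ite_eq' _ q]
  simp only [Finset.mem_range, hq, if_true]
  rw [div_mul_cancel₀ _ (by positivity), sub_self]

/-- Pythagoras: the reduced indicator is the residual of an orthogonal projection of `1_B`, whose
squared norm is the measure of `B`. -/
lemma integral_reducedIndicator_sq_le (m : ℕ) {B : Set ℝ} (hB : MeasurableSet B) :
    ∫ x, reducedIndicator m B x ^ 2 ∂(gaussianReal 0 1) ≤ (gaussianReal 0 1).real B := by
  have hf := memLp_reducedIndicator m hB
  have h1 : ∀ x, B.indicator (1 : ℝ → ℝ) x = reducedIndicator m B x +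
      ∑ q ∈ Finset.range (m + 1), setHermiteCoeff q B / (q.factorial : ℝ) * hermiteFun q x := by
    intro x; simp [reducedIndicator]
  set g : ℝ → ℝ := fun x =>
    ∑ q ∈ Finset.range (m + 1), setHermiteCoeff q B / (q.factorial : ℝ) * hermiteFun q x
  have hg : MemLp g 2 (gaussianReal 0 1) :=
    memLp_finsetSum _ fun q _ => (memLp_hermiteFun q).const_mul _
  have hfg : ∫ x, reducedIndicator m B x * g x ∂(gaussianReal 0 1) = 0 := by
    have h2 : ∀ p, Integrable (fun x => setHermiteCoeff p B / (p.factorial : ℝ) *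
        (reducedIndicator m B x * hermiteFun p x)) (gaussianReal 0 1) := fun p =>
      (hf.integrable_mul (memLp_hermiteFun p)).const_mul _
    simp only [g, Finset.mul_sum, mul_left_comm (reducedIndicator m B _)]
    rw [integral_finsetSum _ fun p _ => h2 p]
    refine Finset.sum_eq_zero fun q hq => ?_
    rw [integral_const_mul, integral_reducedIndicator_mul_hermiteFun hB (Finset.mem_range.1 hq),
      mul_zero]
  have h3 : (gaussianReal 0 1).real B =
      ∫ x, (reducedIndicator m B x ^ 2 + 2 * (reducedIndicator m B x * g x) + g x ^ 2)
        ∂(gaussianReal 0 1) := by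
    rw [← integral_indicator_one hB]
    refine integral_congr_ae (ae_of_all _ fun x => ?_)
    have : B.indicator (1 : ℝ → ℝ) x = B.indicator (1 : ℝ → ℝ) x ^ 2 := by
      by_cases h : x ∈ B <;> simp [h]
    simp only
    rw [this, h1 x]; ring
  have i1 := hf.integrable_sq
  have i2 : Integrable (fun x => 2 * (reducedIndicator m B x * g x)) (gaussianReal 0 1) :=
    (hf.integrable_mul hg).const_mul 2
  have i12 : Integrable (fun x => reducedIndicator m B x ^ 2 + 2 * (reducedIndicator m B x * g x))
    (gaussianReal 0 1) := i1.add i2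
  rw [h3, integral_add i12 hg.integrable_sq, integral_add i1 i2, integral_const_mul, hfg]
  have : 0 ≤ ∫ x, g x ^ 2 ∂(gaussianReal 0 1) := integral_nonneg fun x => sq_nonneg _
  linarith

/-- A stationary standard Gaussian sequence with correlations `ρ`, described through its
two-dimensional marginals. -/
structure IsStandardGaussianSeq {Ω : Type*} [MeasurableSpace Ω] (P : Measure Ω)
    (X : ℕ → Ω → ℝ) (ρ : ℕ → ℝ) : Prop where
  measurePreserving : ∀ i, MeasurePreserving (X i) P (gaussianReal 0 1)
  hasGaussianLaw : ∀ i j, HasGaussianLaw (fun ω => (X i ω, X j ω)) P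
  integral_mul : ∀ i j, ∫ ω, X i ω * X j ω ∂P = ρ (Nat.dist i j)
  abs_le : ∀ k, |ρ k| ≤ 1

lemma integrable_sq_sum_reducedIndicator {Ω : Type*} [MeasurableSpace Ω] {P : Measure Ω}
    {X : ℕ → Ω → ℝ} {ρ : ℕ → ℝ} (hX : IsStandardGaussianSeq P X ρ) (m : ℕ) {B : Set ℝ}
    (hB : MeasurableSet B) (I : Finset ℕ) :
    Integrable (fun ω => (∑ i ∈ I, reducedIndicator m B (X i ω)) ^ 2) P :=
  (memLp_finsetSum _ fun i _ =>
    (memLp_reducedIndicator m hB).comp_measurePreserving (hX.measurePreserving i)).integrable_sq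

/-- The correlation inequality with `k = m + 1` for each pair, then a count of pairs by lag.
Linearity in the measure of `B` is what telescopes along a chain. -/
lemma integral_sq_sum_reducedIndicator_le {Ω : Type*} [MeasurableSpace Ω] {P : Measure Ω}
    [IsProbabilityMeasure P] {X : ℕ → Ω → ℝ} {ρ : ℕ → ℝ} (hX : IsStandardGaussianSeq P X ρ) (m : ℕ) {B : Set ℝ}
    (hB : MeasurableSet B) {a b M : ℕ} (h : b ≤ a + M) :
    ∫ ω, (∑ i ∈ Finset.Ico a b, reducedIndicator m B (X i ω)) ^ 2 ∂P ≤
      (b - a : ℕ) * (2 * ∑ k ∈ Finset.range M, |ρ k| ^ (m + 1)) * (gaussianReal 0 1).real B := by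
  have hL : ∀ i, MemLp (fun ω => reducedIndicator m B (X i ω)) 2 P := fun i =>
    (memLp_reducedIndicator m hB).comp_measurePreserving (hX.measurePreserving i)
  have hI : ∀ i j, Integrable (fun ω => reducedIndicator m B (X i ω) *
      reducedIndicator m B (X j ω)) P := fun i j => (hL i).integrable_mul (hL j)
  simp only [sq, Finset.sum_mul_sum]
  rw [integral_finsetSum _ fun i _ => integrable_finsetSum _ fun j _ => hI i j]
  simp only [integral_finsetSum _ fun j _ => hI _ j]
  have hpair : ∀ i j, ∫ ω, reducedIndicator m B (X i ω) * reducedIndicator m B (X j ω) ∂P ≤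
      |ρ (Nat.dist i j)| ^ (m + 1) * (gaussianReal 0 1).real B := by
    intro i j
    refine (le_abs_self _).trans ((abs_integral_comp_mul_comp_le (hX.measurePreserving i)
      (hX.measurePreserving j) (hX.hasGaussianLaw i j) (by rw [hX.integral_mul]; exact hX.abs_le _)
      (memLp_reducedIndicator m hB) (m + 1)
      fun q hq => integral_reducedIndicator_mul_hermiteFun hB hq).trans ?_)
    rw [hX.integral_mul]
    exact mul_le_mul_of_nonneg_left (integral_reducedIndicator_sq_le m hB)
      (pow_nonneg (abs_nonneg _) _)
  refine (Finset.sum_le_sum fun i _ => Finset.sum_le_sum fun j _ => hpair i j).trans ?_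
  simp only [← Finset.sum_mul]
  exact mul_le_mul_of_nonneg_right (sum_sum_Ico_dist_le (w := fun k => |ρ k| ^ (m + 1))
    (fun k => pow_nonneg (abs_nonneg _) _) h) measureReal_nonneg

/-! ### Bracketing and chaining -/

/-- The finite measure with density `∑_{q ≤ m} |H_q| / q!` with respect to the standard Gaussian. -/
noncomputable def hermiteMajorant (m : ℕ) : Measure ℝ :=
  (gaussianReal 0 1).withDensity fun x =>
    ENNReal.ofReal (∑ q ∈ Finset.range (m + 1), |hermiteFun q x| / (q.factorial : ℝ))

lemma integrable_sum_abs_hermiteFun (m : ℕ) :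
    Integrable (fun x => ∑ q ∈ Finset.range (m + 1), |hermiteFun q x| / (q.factorial : ℝ))
      (gaussianReal 0 1) :=
  integrable_finsetSum _ fun q _ => (integrable_hermiteFun q).abs.div_const _

instance (m : ℕ) : IsFiniteMeasure (hermiteMajorant m) :=
  isFiniteMeasure_withDensity_ofReal (integrable_sum_abs_hermiteFun m).2

lemma abs_setHermiteCoeff_div_le {m q : ℕ} (hq : q < m + 1) {B : Set ℝ} (hB : MeasurableSet B) :
    |setHermiteCoeff q B / (q.factorial : ℝ)| ≤ (hermiteMajorant m).real B := by
  have h1 : (hermiteMajorant m).real B = ∫ x in B, ∑ q ∈ Finset.range (m + 1),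
      |hermiteFun q x| / (q.factorial : ℝ) ∂(gaussianReal 0 1) := by
    rw [Measure.real, hermiteMajorant, withDensity_apply _ hB,
      integral_eq_lintegral_of_nonneg_ae (ae_of_all _ fun x => Finset.sum_nonneg fun q _ =>
        by positivity) (integrable_sum_abs_hermiteFun m).aestronglyMeasurable.restrict]
  rw [h1, setHermiteCoeff, ← integral_div]
  refine abs_integral_le_integral_abs.trans (integral_mono
    ((integrable_hermiteFun q).div_const _).abs.integrableOn
    (integrable_sum_abs_hermiteFun m).integrableOn fun x => ?_)
  simp only [abs_div, Nat.abs_cast]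
  exact Finset.single_le_sum (f := fun q => |hermiteFun q x| / (q.factorial : ℝ))
    (fun q _ => by positivity) (Finset.mem_range.2 hq)

/-- The indicator is nonnegative, so only the Hermite part can be negative, and the majorant of `C`
dominates its coefficients. -/
lemma neg_le_sum_reducedIndicator (m : ℕ) {B C : Set ℝ} (hBC : B ⊆ C) (hB : MeasurableSet B)
    (I : Finset ℕ) (y : ℕ → ℝ) :
    -((hermiteMajorant m).real C * ∑ i ∈ I, ∑ q ∈ Finset.range (m + 1), |hermiteFun q (y i)|) ≤
      ∑ i ∈ I, reducedIndicator m B (y i) := by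
  rw [Finset.mul_sum, ← Finset.sum_neg_distrib]
  refine Finset.sum_le_sum fun i _ => ?_
  have h1 : 0 ≤ B.indicator (1 : ℝ → ℝ) (y i) := Set.indicator_nonneg (by simp) _
  have h2 : ∑ q ∈ Finset.range (m + 1), setHermiteCoeff q B / (q.factorial : ℝ) * hermiteFun q (y i)
      ≤ (hermiteMajorant m).real C * ∑ q ∈ Finset.range (m + 1), |hermiteFun q (y i)| := by
    rw [Finset.mul_sum]
    refine Finset.sum_le_sum fun q hq => (le_abs_self _).trans ?_
    rw [abs_mul]
    gcongr
    exact (abs_setHermiteCoeff_div_le (Finset.mem_range.1 hq) hB).trans (measureReal_mono hBC)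
  unfold reducedIndicator
  linarith

/-- Bracketing: sums over a set between two others are controlled by those over the brackets. -/
lemma abs_sum_reducedIndicator_le (m : ℕ) {V A V' : Set ℝ} (hVA : V ⊆ A) (hAV : A ⊆ V')
    (hV : MeasurableSet V) (hA : MeasurableSet A) (hV' : MeasurableSet V') (I : Finset ℕ)
    (y : ℕ → ℝ) :
    |∑ i ∈ I, reducedIndicator m A (y i)| ≤
      2 * |∑ i ∈ I, reducedIndicator m V (y i)| + |∑ i ∈ I, reducedIndicator m V' (y i)| +
      (hermiteMajorant m).real (V' \ V) *
        ∑ i ∈ I, ∑ q ∈ Finset.range (m + 1), |hermiteFun q (y i)| := by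
  -- The sum over `A` exceeds that over `V` by the one over `A \ V`, and falls short of that over
  -- `V'` by the one over `V' \ A`. Lower bounds for these two differences suffice.
  have h1 := neg_le_sum_reducedIndicator m (Set.sdiff_subset_sdiff_left hAV : A \ V ⊆ V' \ V)
    (hA.diff hV) I y
  have h2 := neg_le_sum_reducedIndicator m (Set.sdiff_subset_sdiff_right hVA : V' \ A ⊆ V' \ V)
    (hV'.diff hA) I y
  simp only [reducedIndicator_diff m hVA hV hA, reducedIndicator_diff m hAV hA hV',
    Finset.sum_sub_distrib] at h1 h2
  have a1 := neg_abs_le (∑ i ∈ I, reducedIndicator m V (y i))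
  have a2 := le_abs_self (∑ i ∈ I, reducedIndicator m V' (y i))
  have a3 := abs_nonneg (∑ i ∈ I, reducedIndicator m V' (y i))
  rw [abs_le]
  constructor <;> linarith [abs_nonneg (∑ i ∈ I, reducedIndicator m V (y i))]

/-- The pullback of a chain for `μ.map G`, with `∅` prepended so that sums along the chain telescope
from zero; this shifts the bracket index `2 * i` to `2 * i + 1`. -/
lemma exists_chain_preimage (μ : Measure ℝ) [IsFiniteMeasure μ] {G : ℝ → ℝ} (hG : Measurable G)
    (N : ℕ) (hN : 0 < N) :
    ∃ V : ℕ → Set ℝ, Monotone V ∧ (∀ j, MeasurableSet (V j)) ∧ V 0 = ∅ ∧ ∀ x : ℝ, ∃ j ≤ 2 * N + 1,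
      V j ⊆ {z | G z ≤ x} ∧ {z | G z ≤ x} ⊆ V (j + 1) ∧
        μ.real (V (j + 1) \ V j) ≤ μ.real Set.univ / N := by
  obtain ⟨W, hmono, hm, hW⟩ := exists_chain_Iic (μ.map G) N hN
  refine ⟨fun j => Nat.casesOn j ∅ fun i => G ⁻¹' W i, monotone_nat_of_le_succ fun j => ?_,
    fun j => ?_, rfl, fun x => ?_⟩
  · cases j with
    | zero => exact Set.empty_subset _
    | succ i => exact Set.preimage_mono (hmono (Nat.le_succ i))
  · cases j with
    | zero => exact MeasurableSet.empty
    | succ i => exact hG (hm i)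
  · obtain ⟨i, hi, h1, h2, h3⟩ := hW x
    refine ⟨2 * i + 1, by lia, fun z hz => h1 hz, fun z hz => h2 hz, ?_⟩
    rw [map_measureReal_apply hG ((hm _).diff (hm _)), map_measureReal_apply hG MeasurableSet.univ,
      Set.preimage_univ] at h3
    exact h3

/-- A square-integrable bound, uniform over a chain of sets and over the times up to `2 ^ K`, for
the sums of the reduced indicators. -/
lemma exists_majorant_of_chain {Ω : Type*} [MeasurableSpace Ω] {P : Measure Ω}
    [IsProbabilityMeasure P] {X : ℕ → Ω → ℝ} {ρ : ℕ → ℝ} (hX : IsStandardGaussianSeq P X ρ) (m : ℕ)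
    {V : ℕ → Set ℝ} (hmono : Monotone V) (hV : ∀ j, MeasurableSet (V j)) (hV0 : V 0 = ∅) (K : ℕ) :
    ∃ Z : Ω → ℝ, Integrable Z P ∧
      ∫ ω, Z ω ∂P ≤ (K : ℝ) ^ 4 * 2 ^ K * (2 * ∑ k ∈ Finset.range (2 ^ K), |ρ k| ^ (m + 1)) ∧
      ∀ ω, ∀ l < 2 ^ K, ∀ i < 2 ^ K,
        (∑ u ∈ Finset.range l, reducedIndicator m (V i) (X u ω)) ^ 2 ≤ Z ω := by
  set A := 2 * ∑ k ∈ Finset.range (2 ^ K), |ρ k| ^ (m + 1)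
  have hA : 0 ≤ A := by positivity
  let D : ℕ → ℕ → Set ℝ := fun s k => V ((k + 1) * 2 ^ s) \ V (k * 2 ^ s)
  have hD : ∀ s k, MeasurableSet (D s k) := fun s k => (hV _).diff (hV _)
  have hle : ∀ s k, k * 2 ^ s ≤ (k + 1) * 2 ^ s := fun s k => Nat.mul_le_mul_right _ (by simp)
  let T : ℕ → ℕ → ℕ → ℕ → Ω → ℝ := fun r j s k ω =>
    (∑ u ∈ Finset.Ico (j * 2 ^ r) ((j + 1) * 2 ^ r), reducedIndicator m (D s k) (X u ω)) ^ 2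
  have hT : ∀ r j s k, Integrable (T r j s k) P := fun r j s k =>
    integrable_sq_sum_reducedIndicator hX m (hD s k) _
  -- For fixed levels `r` and `s`, the measures telescope over `k` to at most one and the `2 ^ (K -
  -- r)` time blocks contribute `2 ^ K * A`. The `K ^ 2` pairs of levels and the prefactor `K ^ 2`
  -- give `K ^ 4`.
  have hTI : ∀ r < K, ∀ j s k, ∫ ω, T r j s k ω ∂P ≤ 2 ^ r * A *
      ((gaussianReal 0 1).real (V ((k + 1) * 2 ^ s)) - (gaussianReal 0 1).real (V (k * 2 ^ s))) := by
    intro r hr j s k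
    have hrK : 2 ^ r ≤ 2 ^ K := Nat.pow_le_pow_right (by simp) hr.le
    refine (integral_sq_sum_reducedIndicator_le hX m (hD s k) (M := 2 ^ K)
      (by rw [add_mul, one_mul]; lia)).trans_eq ?_
    rw [measureReal_sdiff (hmono (hle s k)) (hV _), add_mul, one_mul, Nat.add_sub_cancel_left]
    push_cast
    rfl
  refine ⟨fun ω => (K : ℝ) ^ 2 * ∑ r ∈ Finset.range K, ∑ j ∈ Finset.range (2 ^ (K - r)),
        ∑ s ∈ Finset.range K, ∑ k ∈ Finset.range (2 ^ (K - s)), T r j s k ω, ?_, ?_, ?_⟩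
  · exact (integrable_finsetSum _ fun r _ => integrable_finsetSum _ fun j _ =>
      integrable_finsetSum _ fun s _ => integrable_finsetSum _ fun k _ => hT r j s k).const_mul _
  · rw [integral_const_mul, integral_finsetSum _ fun r _ => integrable_finsetSum _ fun j _ =>
      integrable_finsetSum _ fun s _ => integrable_finsetSum _ fun k _ => hT r j s k]
    have hr : ∀ r ∈ Finset.range K, ∫ ω, ∑ j ∈ Finset.range (2 ^ (K - r)),
        ∑ s ∈ Finset.range K, ∑ k ∈ Finset.range (2 ^ (K - s)), T r j s k ω ∂P ≤ 2 ^ K * A * K := by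
      intro r hr
      rw [Finset.mem_range] at hr
      rw [integral_finsetSum _ fun j _ =>
        integrable_finsetSum _ fun s _ => integrable_finsetSum _ fun k _ => hT r j s k]
      have hj : ∀ j ∈ Finset.range (2 ^ (K - r)), ∫ ω,
          ∑ s ∈ Finset.range K, ∑ k ∈ Finset.range (2 ^ (K - s)), T r j s k ω ∂P ≤ K * (2 ^ r * A) := by
        intro j _
        rw [integral_finsetSum _ fun s _ => integrable_finsetSum _ fun k _ => hT r j s k]
        have hs : ∀ s ∈ Finset.range K,
            ∫ ω, ∑ k ∈ Finset.range (2 ^ (K - s)), T r j s k ω ∂P ≤ 2 ^ r * A := by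
          intro s _
          rw [integral_finsetSum _ fun k _ => hT r j s k]
          refine (Finset.sum_le_sum fun k _ => hTI r hr j s k).trans ?_
          rw [← Finset.mul_sum,
            Finset.sum_range_sub fun k => (gaussianReal 0 1).real (V (k * 2 ^ s)), zero_mul, hV0,
            measureReal_empty, sub_zero]
          exact mul_le_of_le_one_right (by positivity) measureReal_le_one
        refine (Finset.sum_le_sum hs).trans_eq ?_
        rw [Finset.sum_const, Finset.card_range, nsmul_eq_mul]
      refine (Finset.sum_le_sum hj).trans_eq ?_
      rw [Finset.sum_const, Finset.card_range, nsmul_eq_mul]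
      have : (2 : ℝ) ^ K = 2 ^ (K - r) * 2 ^ r := by rw [← pow_add, Nat.sub_add_cancel hr.le]
      rw [this]; push_cast; ring
    calc _ ≤ (K : ℝ) ^ 2 * ∑ r ∈ Finset.range K, 2 ^ K * A * (K : ℝ) := by
          gcongr with r h; exact hr r h
      _ = _ := by rw [Finset.sum_const, Finset.card_range, nsmul_eq_mul]; ring
  · intro ω l hl i hi
    let a : ℕ → ℕ → ℝ := fun u v =>
      reducedIndicator m (V (v + 1)) (X u ω) - reducedIndicator m (V v) (X u ω)
    have h := sq_sum_sum_range_le_dyadic K a l i hl hi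
    have h1 : ∀ u, ∑ v ∈ Finset.range i, a u v = reducedIndicator m (V i) (X u ω) := fun u => by
      rw [Finset.sum_range_sub fun v => reducedIndicator m (V v) (X u ω), hV0,
        reducedIndicator_empty, sub_zero]
    have h2 : ∀ u s k, ∑ v ∈ Finset.Ico (k * 2 ^ s) ((k + 1) * 2 ^ s), a u v =
        reducedIndicator m (D s k) (X u ω) := fun u s k => by
      rw [Finset.sum_Ico_sub (fun v => reducedIndicator m (V v) (X u ω)) (hle s k),
        reducedIndicator_diff m (hmono (hle s k)) (hV _) (hV _)]
    simp only [h1, h2] at h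
    exact h

/-! ### Tail bound for the supremum -/

lemma hermiteCoeff_eq_setHermiteCoeff {Ω : Type*} [MeasurableSpace Ω] {P : Measure Ω}
    {ξ : Ω → ℝ} (hξ : MeasurePreserving ξ P (gaussianReal 0 1)) {G : ℝ → ℝ} (hG : Measurable G)
    (q : ℕ) (x : ℝ) : hermiteCoeff P ξ G q x = setHermiteCoeff q {z | G z ≤ x} := by
  have hS : MeasurableSet {z | G z ≤ x} := hG measurableSet_Iic
  rw [← integral_indicator_mul_hermiteFun hS]
  exact integral_comp_of_measurePreserving hξ
    ((measurable_one.indicator hS).mul (measurable_hermiteFun q))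

lemma reducedSum_eq_sum_reducedIndicator {Ω : Type*} [MeasurableSpace Ω] {P : Measure Ω}
    {X : ℕ → Ω → ℝ} (hX : MeasurePreserving (X 0) P (gaussianReal 0 1)) {G : ℝ → ℝ}
    (hG : Measurable G) (m l : ℕ) (x : ℝ) (ω : Ω) :
    reducedSum P X G m l x ω =
      ∑ i ∈ Finset.range l, reducedIndicator m {z | G z ≤ x} (X i ω) := by
  simp only [reducedSum, hermiteCoeff_eq_setHermiteCoeff hX hG]
  rfl

lemma integrable_sq_sum_abs_hermiteFun {Ω : Type*} [MeasurableSpace Ω] {P : Measure Ω}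
    [IsProbabilityMeasure P] {X : ℕ → Ω → ℝ}
    (hX : ∀ i, MeasurePreserving (X i) P (gaussianReal 0 1)) (m n : ℕ) :
    Integrable (fun ω => (∑ i ∈ Finset.range n, ∑ q ∈ Finset.range (m + 1),
      |hermiteFun q (X i ω)|) ^ 2) P ∧
    ∫ ω, (∑ i ∈ Finset.range n, ∑ q ∈ Finset.range (m + 1), |hermiteFun q (X i ω)|) ^ 2 ∂P ≤
      (n : ℝ) ^ 2 * ((m + 1) * ∑ q ∈ Finset.range (m + 1), (q.factorial : ℝ)) := by
  have hL : ∀ i q, MemLp (fun ω => |hermiteFun q (X i ω)|) 2 P := fun i q =>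
    ((memLp_hermiteFun q).comp_measurePreserving (hX i)).abs
  have hI : ∀ i q, ∫ ω, |hermiteFun q (X i ω)| ^ 2 ∂P = q.factorial := fun i q => by
    simp only [sq_abs]
    rw [integral_comp_of_measurePreserving (hX i) (f := fun x => hermiteFun q x ^ 2)
      ((measurable_hermiteFun q).pow_const 2)]
    simpa [sq] using integral_hermiteFun_mul_hermiteFun_gaussianReal q q
  have h1 := (memLp_finsetSum (Finset.range n) fun i _ =>
    memLp_finsetSum (Finset.range (m + 1)) fun q _ => hL i q).integrable_sq
  refine ⟨h1, ?_⟩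
  have h2 : Integrable (fun ω => (n : ℝ) * ∑ i ∈ Finset.range n, ((m + 1 : ℝ) *
      ∑ q ∈ Finset.range (m + 1), |hermiteFun q (X i ω)| ^ 2)) P :=
    (integrable_finsetSum _ fun i _ =>
      (integrable_finsetSum _ fun q _ => (hL i q).integrable_sq).const_mul _).const_mul _
  refine (integral_mono h1 h2 fun ω => ?_).trans_eq ?_
  · have := sq_sum_le_card_mul_sum_sq (s := Finset.range n)
      (f := fun i => ∑ q ∈ Finset.range (m + 1), |hermiteFun q (X i ω)|)
    rw [Finset.card_range] at this
    refine this.trans ?_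
    gcongr with i _
    have := sq_sum_le_card_mul_sum_sq (s := Finset.range (m + 1))
      (f := fun q => |hermiteFun q (X i ω)|)
    rw [Finset.card_range] at this
    exact_mod_cast this
  · rw [integral_const_mul, integral_finsetSum _ fun i _ =>
      (integrable_finsetSum _ fun q _ => (hL i q).integrable_sq).const_mul _]
    simp only [integral_const_mul, integral_finsetSum _ fun q _ => (hL _ q).integrable_sq, hI]
    rw [Finset.sum_const, Finset.card_range, nsmul_eq_mul]
    ring

lemma hermiteNorm_sq {Ω : Type*} [MeasurableSpace Ω] {P : Measure Ω}
    [IsProbabilityMeasure P] {X : ℕ → Ω → ℝ} {ρ : ℕ → ℝ} (hX : IsStandardGaussianSeq P X ρ)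
    {m : ℕ} (hm : 1 ≤ m) (n : ℕ) :
    hermiteNorm P X n m ^ 2 = (m.factorial : ℝ) *
      ∑ i ∈ Finset.range n, ∑ j ∈ Finset.range n, ρ (Nat.dist i j) ^ m := by
  have hL : ∀ i, MemLp (fun ω => hermiteFun m (X i ω)) 2 P := fun i =>
    (memLp_hermiteFun m).comp_measurePreserving (hX.measurePreserving i)
  have h0 : ∫ ω, ∑ i ∈ Finset.range n, hermiteFun m (X i ω) ∂P = 0 := by
    rw [integral_finsetSum _ fun i _ => (hL i).integrable (by norm_num)]
    refine Finset.sum_eq_zero fun i _ => ?_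
    rw [integral_comp_of_measurePreserving (hX.measurePreserving i) (measurable_hermiteFun m)]
    have := integral_hermiteFun_mul_hermiteFun_gaussianReal m 0
    simpa [hermiteFun_eq_eval 0, hermiteReal_zero, show m ≠ 0 by lia] using this
  rw [hermiteNorm, Real.sq_sqrt (variance_nonneg _ _), variance_of_integral_eq_zero
    (memLp_finsetSum _ fun i _ => hL i).aestronglyMeasurable.aemeasurable h0]
  have hI : ∀ i j, Integrable (fun ω => hermiteFun m (X i ω) * hermiteFun m (X j ω)) P :=
    fun i j => (hL i).integrable_mul (hL j)
  simp only [sq, Finset.sum_mul_sum]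
  rw [integral_finsetSum _ fun i _ => integrable_finsetSum _ fun j _ => hI i j]
  simp only [integral_finsetSum _ fun j _ => hI _ j, Finset.mul_sum]
  refine Finset.sum_congr rfl fun i _ => Finset.sum_congr rfl fun j _ => ?_
  rw [integral_hermiteFun_mul_hermiteFun (hX.measurePreserving i) (hX.measurePreserving j)
    (hX.hasGaussianLaw i j), hX.integral_mul, if_pos rfl]

lemma lt_supReduced_iff {Ω : Type*} [MeasurableSpace Ω] {P : Measure Ω} {X : ℕ → Ω → ℝ}
    {G : ℝ → ℝ} {m n : ℕ} {ω : Ω} {ε : ℝ} (hε : 0 < ε) :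
    ENNReal.ofReal ε < supReduced P X G m n ω ↔ ∃ t ∈ Set.Ioo (0 : ℝ) 1, ∃ x : ℝ,
      ε < 1 / hermiteNorm P X n m * |reducedSum P X G m ⌊(n : ℝ) * t⌋₊ x ω| := by
  simp only [supReduced, lt_iSup_iff, ENNReal.ofReal_lt_ofReal_iff_of_nonneg hε.le, exists_prop]

/-- The tail bound in terms of the correlations and of the normalization. -/
lemma measureReal_lt_supReduced_le {Ω : Type*} [MeasurableSpace Ω] {P : Measure Ω}
    [IsProbabilityMeasure P] {X : ℕ → Ω → ℝ} {ρ : ℕ → ℝ} (hX : IsStandardGaussianSeq P X ρ)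
    {G : ℝ → ℝ} (hG : Measurable G) (m n R : ℕ) (hn : n ≤ 2 ^ R) {ε : ℝ} (hε : 0 < ε) :
    P.real {ω | ENNReal.ofReal ε < supReduced P X G m n ω} ≤
      (30 * (((R + 3 : ℕ) : ℝ) ^ 4 * 2 ^ (R + 3) *
          ∑ k ∈ Finset.range (2 ^ (R + 3)), |ρ k| ^ (m + 1)) +
        3 * (hermiteMajorant m).real Set.univ ^ 2 *
          ((m + 1) * ∑ q ∈ Finset.range (m + 1), (q.factorial : ℝ))) /
        (ε ^ 2 * hermiteNorm P X n m ^ 2) := by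
  set d := hermiteNorm P X n m with hd
  set K := R + 3
  set T := (hermiteMajorant m).real Set.univ
  set c := (m + 1) * ∑ q ∈ Finset.range (m + 1), (q.factorial : ℝ)
  have hd0 : 0 ≤ d := Real.sqrt_nonneg _
  -- For `d = 0` the convention `1 / 0 = 0` makes the supremum zero and the event empty.
  rcases hd0.eq_or_lt with h0 | hdpos
  · have : {ω | ENNReal.ofReal ε < supReduced P X G m n ω} = ∅ := by
      ext ω
      simp only [Set.mem_ofPred_eq, Set.mem_empty_iff_false, iff_false, lt_supReduced_iff hε, ← hd,
        ← h0]
      rintro ⟨t, _, x, h⟩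
      simp at h
      linarith
    rw [this, measureReal_empty]
    positivity
  -- With `2 ^ R ≥ n` levels each bracket has mass at most `T / 2 ^ R`. As `Y` is `O(n)` in `L²`,
  -- the bracketing error is bounded in `L²`.
  obtain ⟨V, hmono, hV, hV0, hchain⟩ := exists_chain_preimage (hermiteMajorant m) hG (2 ^ R)
    (by positivity)
  obtain ⟨Z, hZi, hZ, hZle⟩ := exists_majorant_of_chain hX m hmono hV hV0 K
  let Y : Ω → ℝ := fun ω => ∑ i ∈ Finset.range n, ∑ q ∈ Finset.range (m + 1), |hermiteFun q (X i ω)|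
  obtain ⟨hYi, hY⟩ := integrable_sq_sum_abs_hermiteFun hX.measurePreserving m n
  have hZ0 : ∀ ω, 0 ≤ Z ω := fun ω =>
    (sq_nonneg _).trans (hZle ω 0 (by positivity) 0 (by positivity))
  have hN : (0 : ℝ) < 2 ^ R := by positivity
  -- From `(2a + b + c)² ≤ 3 (4a² + b² + c²)` with `a²` and `b²` at most `Z`.
  let B : Ω → ℝ := fun ω => 15 * Z ω + 3 * (T / 2 ^ R) ^ 2 * Y ω ^ 2
  have hBi : Integrable B P := (hZi.const_mul _).add (hYi.const_mul _)
  have hsub : {ω | ENNReal.ofReal ε < supReduced P X G m n ω} ⊆ {ω | ε ^ 2 * d ^ 2 ≤ B ω} := by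
    intro ω hω
    obtain ⟨t, ht, x, hx⟩ := (lt_supReduced_iff hε).1 hω
    rw [reducedSum_eq_sum_reducedIndicator (hX.measurePreserving 0) hG, ← hd, one_div,
      ← div_eq_inv_mul, lt_div_iff₀ hdpos] at hx
    set l := ⌊(n : ℝ) * t⌋₊
    have hln : l ≤ n := Nat.floor_le_of_le (by
      have : (0 : ℝ) ≤ n := by positivity
      nlinarith [ht.2])
    -- The chain index `j + 1` can reach `2 * 2 ^ R + 2`, whence `K = R + 3`.
    have hRK : 2 * 2 ^ R + 2 < 2 ^ K := by
      have : 1 ≤ 2 ^ R := Nat.one_le_two_pow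
      simp only [K, pow_succ]; lia
    have hlK : l < 2 ^ K := by lia
    obtain ⟨j, hj, h1, h2, h3⟩ := hchain x
    have hbr := abs_sum_reducedIndicator_le m h1 h2 (hV j) (hG measurableSet_Iic) (hV (j + 1))
      (Finset.range l) fun i => X i ω
    have z1 := hZle ω l hlK j (by lia)
    have z2 := hZle ω l hlK (j + 1) (by lia)
    have hYl : ∑ i ∈ Finset.range l, ∑ q ∈ Finset.range (m + 1), |hermiteFun q (X i ω)| ≤ Y ω :=
      Finset.sum_le_sum_of_subset_of_nonneg (Finset.range_mono hln)
        fun i _ _ => Finset.sum_nonneg fun q _ => abs_nonneg _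
    have hY0 : 0 ≤ Y ω := Finset.sum_nonneg fun i _ => Finset.sum_nonneg fun q _ => abs_nonneg _
    set s1 := ∑ i ∈ Finset.range l, reducedIndicator m (V j) (X i ω)
    set s2 := ∑ i ∈ Finset.range l, reducedIndicator m (V (j + 1)) (X i ω)
    have hb : (hermiteMajorant m).real (V (j + 1) \ V j) *
        ∑ i ∈ Finset.range l, ∑ q ∈ Finset.range (m + 1), |hermiteFun q (X i ω)| ≤
        T / 2 ^ R * Y ω := by
      push_cast at h3
      gcongr
    have hfin : ε * d ≤ 2 * |s1| + |s2| + T / 2 ^ R * Y ω := by linarith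
    have hsq := pow_le_pow_left₀ (by positivity) hfin 2
    rw [← sq_abs] at z1 z2
    change ε ^ 2 * d ^ 2 ≤ 15 * Z ω + 3 * (T / 2 ^ R) ^ 2 * Y ω ^ 2
    nlinarith [sq_nonneg (2 * |s1| - |s2|), sq_nonneg (2 * |s1| - T / 2 ^ R * Y ω),
      sq_nonneg (|s2| - T / 2 ^ R * Y ω)]
  have hB0 : 0 ≤ᵐ[P] B := ae_of_all _ fun ω => by
    have := hZ0 ω
    simp only [B, Pi.zero_apply]; positivity
  have hmk := mul_meas_ge_le_integral_of_nonneg hB0 hBi (ε ^ 2 * d ^ 2)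
  rw [le_div_iff₀ (by positivity), mul_comm]
  refine (mul_le_mul_of_nonneg_left (measureReal_mono hsub) (by positivity)).trans (hmk.trans ?_)
  rw [integral_add (hZi.const_mul _) (hYi.const_mul _), integral_const_mul, integral_const_mul]
  have hYn : (T / 2 ^ R) ^ 2 * ∫ ω, Y ω ^ 2 ∂P ≤ T ^ 2 * c := by
    have hn' : (n : ℝ) ≤ 2 ^ R := by exact_mod_cast hn
    calc (T / 2 ^ R) ^ 2 * ∫ ω, Y ω ^ 2 ∂P ≤ (T / 2 ^ R) ^ 2 * ((2 ^ R) ^ 2 * c) := by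
          refine mul_le_mul_of_nonneg_left (hY.trans ?_) (by positivity)
          gcongr
      _ = T ^ 2 * c := by field_simp
  have : 3 * (T / 2 ^ R) ^ 2 * ∫ ω, Y ω ^ 2 ∂P ≤ 3 * T ^ 2 * c := by nlinarith
  refine (add_le_add (mul_le_mul_of_nonneg_left hZ (by norm_num : (0 : ℝ) ≤ 15)) this).trans_eq ?_
  ring

/-! ### Stationarity, choice of exponents and conclusion -/

lemma isStandardGaussianSeq_of_stationary {Ω : Type*} [MeasurableSpace Ω] {P : Measure Ω}
    [IsProbabilityMeasure P] {X : ℕ → Ω → ℝ} (hmeas : ∀ i, Measurable (X i))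
    (hgauss : IsGaussianProcess X P) (hstat : IsStrictlyStationary X P)
    (hmean : ∀ i, ∫ ω, X i ω ∂P = 0) (hvar : ∀ i, ∫ ω, (X i ω) ^ 2 ∂P = 1) :
    IsStandardGaussianSeq P X fun k => ∫ ω, X 0 ω * X k ω ∂P where
  measurePreserving i := by
    refine ⟨hmeas i, ?_⟩
    rw [(hgauss.hasGaussianLaw_eval i).map_eq_gaussianReal, hmean,
      variance_of_integral_eq_zero (hmeas i).aemeasurable (hmean i), hvar]
    simp
  hasGaussianLaw i j := hgauss.hasGaussianLaw_prodMk
  integral_mul i j := by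
    have key : ∀ i k, ∫ ω, X i ω * X (k + i) ω ∂P = ∫ ω, X 0 ω * X k ω ∂P := fun i k => by
      have hu : Measurable fun f : ℕ → ℝ => f 0 * f k := by fun_prop
      simpa [Function.comp_def] using ((hstat i).comp hu).integral_eq
    rcases le_total i j with h | h
    · have := key i (j - i)
      rw [Nat.sub_add_cancel h] at this
      rw [this, Nat.dist_eq_sub_of_le h]
    · have := key j (i - j)
      rw [Nat.sub_add_cancel h] at this
      rw [Nat.dist_eq_sub_of_le_right h, ← this]
      simp only [mul_comm]
  abs_le k := by
    have hL : ∀ i, MemLp (X i) 2 P := fun i => (hgauss.hasGaussianLaw_eval i).memLp_two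
    have h1 : Integrable (fun ω => X 0 ω ^ 2 + X k ω ^ 2) P :=
      (hL 0).integrable_sq.add (hL k).integrable_sq
    refine abs_integral_le_integral_abs.trans ?_
    have h2 := integral_mono ((hL 0).integrable_mul (hL k)).abs (h1.div_const 2) fun ω => by
      simp only [Pi.mul_apply, abs_mul]
      nlinarith [sq_nonneg (|X 0 ω| - |X k ω|), sq_abs (X 0 ω), sq_abs (X k ω)]
    refine h2.trans_eq ?_
    rw [integral_div, integral_add (hL 0).integrable_sq (hL k).integrable_sq, hvar, hvar]
    norm_num

lemma eventually_rpow_le_of_regularlyVarying {D : ℝ} {L : ℝ → ℝ} (hL : IsSlowlyVarying L)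
    {ρ : ℕ → ℝ} (hρ : ∀ k : ℕ, 1 ≤ k → ρ k = (k : ℝ) ^ (-D) * L k) {δ : ℝ} (hδ : 0 < δ) :
    ∀ᶠ k : ℕ in atTop, (k : ℝ) ^ (-(D + δ)) ≤ ρ k ∧ |ρ k| ≤ (k : ℝ) ^ (-(D - δ)) := by
  filter_upwards [tendsto_natCast_atTop_atTop.eventually (hL.eventually_rpow_le hδ),
    eventually_ge_atTop 1] with k hk hk1
  have hk0 : (0 : ℝ) < k := by exact_mod_cast hk1
  have h0 : (0 : ℝ) < (k : ℝ) ^ (-δ) := Real.rpow_pos_of_pos hk0 _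
  have h1 : (k : ℝ) ^ (-(D + δ)) = (k : ℝ) ^ (-D) * (k : ℝ) ^ (-δ) := by
    rw [← Real.rpow_add hk0]; ring_nf
  have h2 : (k : ℝ) ^ (-(D - δ)) = (k : ℝ) ^ (-D) * (k : ℝ) ^ δ := by
    rw [← Real.rpow_add hk0]; ring_nf
  have h3 : 0 ≤ (k : ℝ) ^ (-D) := by positivity
  rw [hρ k hk1, h1, h2, abs_of_nonneg (mul_nonneg h3 (h0.le.trans hk.1))]
  exact ⟨by gcongr; exact hk.1, by gcongr; exact hk.2⟩

/-- `d_{n,m} ^ 2` will be at least of order `n ^ (2 - α)` and the reduced variance at most of order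
`n ^ (2 - β)`, up to logarithms. The room for `α < β` is the gap `b` between `m * D` and `min ((m +
1) * D) 1`; `δ` is small enough to use only a quarter of it on either side. -/
lemma exists_exponents {D : ℝ} (hD0 : 0 < D) {m : ℕ} (hmD : m * D < 1) :
    ∃ δ α β : ℝ, 0 < δ ∧ 0 ≤ α ∧ α < β ∧ β < 1 ∧ α = (D + δ) * m ∧ β ≤ (D - δ) * (m + 1) := by
  set b := min ((m + 1) * D) 1 - m * D
  have hb : 0 < b := sub_pos.2 (lt_min (by linarith) hmD)
  have hb1 : b ≤ D := by
    have := min_le_left ((m + 1) * D) 1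
    simp only [b]; linarith
  have hb2 : b ≤ 1 - m * D := by
    have := min_le_right ((m + 1) * D) 1
    simp only [b]; linarith
  have hm0 : (0 : ℝ) ≤ m := by positivity
  have e : b / (4 * (m + 1)) * (m + 1) = b / 4 := by field_simp
  have hδ : 0 < b / (4 * (m + 1)) := by positivity
  refine ⟨b / (4 * (m + 1)), (D + b / (4 * (m + 1))) * m, m * D + b / 2, hδ, by positivity, ?_, ?_,
    rfl, ?_⟩
  · nlinarith
  · nlinarith
  · nlinarith

lemma exists_two_pow_between {n : ℕ} (hn : 1 ≤ n) : ∃ R, n ≤ 2 ^ R ∧ 2 ^ R ≤ 2 * n :=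
  ⟨Nat.log 2 n + 1, (Nat.lt_pow_succ_log_self (by simp) n).le, by
    have := Nat.pow_log_le_self 2 (show n ≠ 0 by lia)
    rw [pow_succ]; lia⟩

lemma one_div_sq_le_one_add_zpow {ε : ℝ} (hε : 0 < ε) : 1 / ε ^ 2 ≤ 1 + ε ^ (-3 : ℤ) := by
  have h3 : ε ^ (-3 : ℤ) = 1 / ε ^ 3 := by
    rw [zpow_neg, one_div]; norm_cast
  have h0 : 0 < 1 / ε ^ 3 := by positivity
  rw [h3]
  rcases le_total 1 ε with h | h
  · have : 1 / ε ^ 2 ≤ 1 := by rw [div_le_one (by positivity)]; nlinarith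
    linarith
  · have : 1 / ε ^ 2 ≤ 1 / ε ^ 3 := one_div_le_one_div_of_le (by positivity) (by
      calc ε ^ 3 = ε ^ 2 * ε := by ring
        _ ≤ ε ^ 2 * 1 := by gcongr
        _ = ε ^ 2 := by ring)
    linarith

/-- The chaining bound has polynomial order `2 - β + 4 η` for every `η > 0`. -/
lemma exists_numerator_le {w : ℕ → ℝ} {C₁ β η c : ℝ} (hC₁ : 0 < C₁) (hc : 0 ≤ c) (hη : 0 < η)
    (hβ : β < 1) (hw : ∀ M : ℕ, ∑ k ∈ Finset.range M, w k ≤ C₁ * (M : ℝ) ^ (1 - β)) :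
    ∃ C, 0 < C ∧ ∀ n R : ℕ, 1 ≤ n → 2 ^ R ≤ 2 * n →
      30 * (((R + 3 : ℕ) : ℝ) ^ 4 * 2 ^ (R + 3) * ∑ k ∈ Finset.range (2 ^ (R + 3)), w k) + c ≤
        C * (n : ℝ) ^ (2 - β + 4 * η) := by
  obtain ⟨C₂, hC₂, hK⟩ := exists_natCast_le_rpow_two_pow hη
  set γ := 2 - β + 4 * η
  have hγ : 0 ≤ γ := by simp only [γ]; linarith
  -- The factor `16 ^ γ` comes from `2 ^ (R + 3) ≤ 16 * n`, and `c` is absorbed because `n ^ γ ≥ 1`.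
  refine ⟨30 * (C₂ ^ 4 * C₁) * 16 ^ γ + c, by positivity, fun n R hn hR => ?_⟩
  have hn' : (1 : ℝ) ≤ n := by exact_mod_cast hn
  set x : ℝ := 2 ^ (R + 3) with hx
  have hx0 : 0 < x := by positivity
  have hxn : x ≤ 16 * n := by
    have : (2 : ℝ) ^ R ≤ 2 * n := by exact_mod_cast hR
    rw [hx, pow_add]; linarith
  have h1 : ∑ k ∈ Finset.range (2 ^ (R + 3)), w k ≤ C₁ * x ^ (1 - β) := by
    have := hw (2 ^ (R + 3))
    push_cast at this
    exact this
  have h2 : ((R + 3 : ℕ) : ℝ) ^ 4 ≤ (C₂ * x ^ η) ^ 4 :=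
    pow_le_pow_left₀ (by positivity) (hK (R + 3)) 4
  have h3 : (C₂ * x ^ η) ^ 4 * x * (C₁ * x ^ (1 - β)) = C₂ ^ 4 * C₁ * x ^ γ := by
    have e1 : (x ^ η) ^ 4 = x ^ (4 * η) := by
      rw [← Real.rpow_natCast, ← Real.rpow_mul hx0.le]; push_cast; ring_nf
    have e2 : x ^ γ = x ^ (4 * η) * x * x ^ (1 - β) := by
      rw [← Real.rpow_add_one hx0.ne', ← Real.rpow_add hx0]; congr 1; simp only [γ]; ring
    rw [mul_pow, e1, e2]; ring
  have h4 : x ^ γ ≤ 16 ^ γ * (n : ℝ) ^ γ := by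
    rw [← Real.mul_rpow (by norm_num) (by linarith)]
    exact Real.rpow_le_rpow hx0.le hxn hγ
  have h5 : 1 ≤ (n : ℝ) ^ γ := Real.one_le_rpow hn' hγ
  calc 30 * (((R + 3 : ℕ) : ℝ) ^ 4 * x * ∑ k ∈ Finset.range (2 ^ (R + 3)), w k) + c
      ≤ 30 * ((C₂ * x ^ η) ^ 4 * x * (C₁ * x ^ (1 - β))) + c * (n : ℝ) ^ γ := by
        refine add_le_add (mul_le_mul_of_nonneg_left ?_ (by norm_num)) (le_mul_of_one_le_right hc h5)
        exact (mul_le_mul_of_nonneg_left h1 (by positivity)).trans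
          (mul_le_mul_of_nonneg_right (mul_le_mul_of_nonneg_right h2 hx0.le) (by positivity))
    _ ≤ 30 * (C₂ ^ 4 * C₁ * (16 ^ γ * (n : ℝ) ^ γ)) + c * (n : ℝ) ^ γ := by
        rw [h3]; gcongr
    _ = _ := by ring

theorem mainTheorem3 {Ω : Type*} [MeasurableSpace Ω] (P : Measure Ω) [IsProbabilityMeasure P]
    (X : ℕ → Ω → ℝ) (hmeas : ∀ i, Measurable (X i))
    (hgauss : IsGaussianProcess X P) (hstat : IsStrictlyStationary X P)
    (hmean : ∀ i, ∫ ω, X i ω ∂P = 0) (hvar : ∀ i, ∫ ω, (X i ω) ^ 2 ∂P = 1)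
    (D : ℝ) (hD0 : 0 < D) (hD1 : D < 1) (L : ℝ → ℝ) (hL : IsSlowlyVarying L)
    (hcov : ∀ k : ℕ, 1 ≤ k → ∫ ω, X 0 ω * X k ω ∂P = (k : ℝ) ^ (-D) * L k)
    (G : ℕ → ℝ → ℝ) (hG : ∀ n, Measurable (G n))
    (m n₀ : ℕ) (hrank : ∀ n, n₀ ≤ n → hermiteRank P (X 0) (G n) ≤ (m : ℕ∞))
    (hm : (m : ℝ) < 1 / D) :
    ∃ C κ : ℝ, 0 < C ∧ 0 < κ ∧ ∀ n : ℕ, 1 ≤ n → ∀ ε : ℝ, 0 < ε →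
      P.real {ω | ENNReal.ofReal ε < supReduced P X (G n) m n ω} ≤
        C * (n : ℝ) ^ (-κ) * (1 + ε ^ (-3 : ℤ)) := by
  -- A Hermite rank is at least one. Thus `H_m` is centred and its variance is a double sum of `ρ ^
  -- m`.
  have hm1 : 1 ≤ m := by
    have h1 : (1 : ℕ∞) ≤ hermiteRank P (X 0) (G n₀) :=
      le_iInf fun q => le_iInf fun hq => by exact_mod_cast hq.1
    exact_mod_cast h1.trans (hrank n₀ le_rfl)
  have hX := isStandardGaussianSeq_of_stationary hmeas hgauss hstat hmean hvar
  set ρ : ℕ → ℝ := fun k => ∫ ω, X 0 ω * X k ω ∂P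
  obtain ⟨δ, α, β, hδ, hα, hαβ, hβ, hαe, hβe⟩ :=
    exists_exponents hD0 (m := m) (by rwa [lt_div_iff₀ hD0] at hm)
  have hρ := eventually_rpow_le_of_regularlyVarying hL hcov hδ
  have hup : ∀ᶠ k : ℕ in atTop, |ρ k| ^ (m + 1) ≤ (k : ℝ) ^ (-β) := by
    filter_upwards [hρ, eventually_ge_atTop 1] with k hk hk1
    have hk1' : (1 : ℝ) ≤ k := by exact_mod_cast hk1
    refine (pow_le_pow_left₀ (abs_nonneg _) hk.2 (m + 1)).trans ?_
    rw [← Real.rpow_natCast, ← Real.rpow_mul (by linarith)]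
    refine Real.rpow_le_rpow_of_exponent_le hk1' ?_
    push_cast
    linarith
  have hlow : ∀ᶠ k : ℕ in atTop, (k : ℝ) ^ (-α) ≤ ρ k ^ m := by
    filter_upwards [hρ] with k hk
    have e : (k : ℝ) ^ (-α) = ((k : ℝ) ^ (-(D + δ))) ^ m := by
      rw [← Real.rpow_natCast, ← Real.rpow_mul (by positivity), hαe]; ring_nf
    rw [e]
    exact pow_le_pow_left₀ (by positivity) hk.1 m
  obtain ⟨C₁, hC₁, hsum⟩ := exists_sum_range_le_rpow
    (fun k => pow_le_one₀ (abs_nonneg _) (hX.abs_le k)) (hα.trans hαβ.le) hβ hup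
  have hρm : ∀ k, -1 ≤ ρ k ^ m := fun k =>
    (abs_le.1 ((abs_pow (ρ k) m).trans_le (pow_le_one₀ (abs_nonneg _) (hX.abs_le k)))).1
  obtain ⟨n₁, hn₁⟩ := eventually_atTop.1
    (eventually_le_sum_sum_dist hρm hα (hαβ.trans hβ) hlow)
  -- This `η` spends half of the gap `β - α` on the logarithms; the other half is `κ`, as `2 - β +
  -- 4η = (2 - α) - κ`.
  obtain ⟨C₂, hC₂, hnum⟩ := exists_numerator_le (η := (β - α) / 8)
    (c := 3 * (hermiteMajorant m).real Set.univ ^ 2 *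
      ((m + 1) * ∑ q ∈ Finset.range (m + 1), (q.factorial : ℝ))) hC₁ (by positivity)
    (by linarith) hβ hsum
  set κ := (β - α) / 2 with hκ
  have hκ0 : 0 < κ := by simp only [κ]; linarith
  -- The second summand makes the bound exceed one for `n < n₁`, where the lower bound on `d_{n,m}`
  -- is unavailable. The factor two comes from the `1 / 2` in that lower bound.
  refine ⟨2 * C₂ + ((n₁ : ℝ) + 1) ^ κ, κ, by positivity, hκ0, fun n hn ε hε => ?_⟩
  have hn' : (1 : ℝ) ≤ n := by exact_mod_cast hn
  have hn0 : (0 : ℝ) < n := by linarith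
  have hε3 : 0 < ε ^ (-3 : ℤ) := by positivity
  have hnκ : 0 < (n : ℝ) ^ (-κ) := Real.rpow_pos_of_pos hn0 _
  rcases lt_or_ge n n₁ with hlt | hge
  · have h1 : 1 ≤ ((n₁ : ℝ) + 1) ^ κ * (n : ℝ) ^ (-κ) := by
      rw [Real.rpow_neg hn0.le, ← div_eq_mul_inv, ← Real.div_rpow (by positivity) hn0.le]
      refine Real.one_le_rpow ?_ hκ0.le
      rw [one_le_div hn0]
      have : (n : ℝ) ≤ n₁ := by exact_mod_cast hlt.le
      linarith
    refine measureReal_le_one.trans ?_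
    have h2 : 1 ≤ (2 * C₂ + ((n₁ : ℝ) + 1) ^ κ) * (n : ℝ) ^ (-κ) := by
      rw [add_mul]
      have : 0 ≤ 2 * C₂ * (n : ℝ) ^ (-κ) := by positivity
      linarith
    exact h2.trans (le_mul_of_one_le_right (by positivity) (by linarith))
  · obtain ⟨R, hR1, hR2⟩ := exists_two_pow_between hn
    refine (measureReal_lt_supReduced_le hX (hG n) m n R hR1 hε).trans ?_
    have hd : (n : ℝ) ^ (2 - α) / 2 ≤ hermiteNorm P X n m ^ 2 := by
      rw [hermiteNorm_sq hX hm1]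
      refine (hn₁ n hge).trans (le_mul_of_one_le_left ?_ ?_)
      · exact le_trans (by positivity) (hn₁ n hge)
      · exact_mod_cast Nat.one_le_iff_ne_zero.2 (Nat.factorial_ne_zero m)
    have hpos : 0 < (n : ℝ) ^ (2 - α) := Real.rpow_pos_of_pos hn0 _
    have hexp : (n : ℝ) ^ (2 - β + 4 * ((β - α) / 8)) = (n : ℝ) ^ (-κ) * (n : ℝ) ^ (2 - α) := by
      rw [← Real.rpow_add hn0]; congr 1; rw [hκ]; ring
    have hnn := hnum n R hn hR2
    rw [hexp] at hnn
    calc _ ≤ C₂ * ((n : ℝ) ^ (-κ) * (n : ℝ) ^ (2 - α)) / (ε ^ 2 * ((n : ℝ) ^ (2 - α) / 2)) := by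
          gcongr
      _ = 2 * C₂ * (n : ℝ) ^ (-κ) * (1 / ε ^ 2) := by field_simp
      _ ≤ (2 * C₂ + ((n₁ : ℝ) + 1) ^ κ) * (n : ℝ) ^ (-κ) * (1 + ε ^ (-3 : ℤ)) := by
          gcongr
          · have : 0 ≤ ((n₁ : ℝ) + 1) ^ κ := by positivity
            linarith
          · exact one_div_sq_le_one_add_zpow hε
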